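/- Let $n\ge 1$, let $\Lambda=\{\lambda\in\mathbb R^n:\lambda_i\ge 0,\ \sum_i\lambda_i=1\}$, and let $P(z,\lambda)=\frac{\sum_{i=0}^{m}b_i(\lambda)z^i}{\sum_{i=0}^{r}a_i(\lambda)z^i}$ be an uncertain plant whose coefficients are real rational functions of $\lambda$ without poles on $\Lambda$ and which is stable for every $\lambda\in\Lambda$ (its denominator has no zero with $|z|\ge 1$). Fix $k_1,k_2,k_3,k_4\in\mathbb N$ and a real FIR filter $Q(z)=\sum_{i=-k_3}^{k_4}q_iz^{-i}$; for $l\in\mathbb R^{k_1+k_2+1}$ let $L(z)=\sum_{i=-k_1}^{k_2}l_iz^{-i}$ and $F_l(z,\lambda)=Q(z)\,[1-zL(z)P(z,\lambda)]$. Consider the min–max problem $$\gamma^*=\min_{l}\ \sup_{\lambda\in\Lambda}\|F_l(\cdot,\lambda)\|_\infty ,\qquad \|G\|_\infty=\sup_{|z|=1}|G(z)|,$$ and its constrained form: find the infimum of $\gamma\ge 0$ over all $(\gamma,l)$ with $\gamma^2-|F_l(z,\lambda)|^2>0$ for all $|z|=1$, $\lambda\in\Lambda$. There are real polynomials $\nu_1,\nu_2,\nu_3$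 in $(x_1,x_2,\lambda)$, where the coefficients of $\nu_1,\nu_2$ are affine in $l$, such that $F_l(x_1+jx_2,\lambda)=\frac{\nu_1(l,x_1,x_2,\lambda)+j\,\nu_2(l,x_1,x_2,\lambda)}{\nu_3(x_1,x_2,\lambda)}$ with $\nu_3\neq0$ whenever $x_1^2+x_2^2=1$ and $\lambda\in\Lambda$. For any such $\nu_1,\nu_2,\nu_3$ put $$T(l,\eta,x_1,x_2,\lambda)=\begin{pmatrix}\eta\,\nu_3^2&\nu_1&\nu_2\\ \nu_1&1&0\\ \nu_2&0&1\end{pmatrix},$$ let $\deg(T,x)$ and $\deg(T,\lambda)$ be the maximal degrees of its entries in $(x_1,x_2)$ and in $\lambda$ (with $l,\eta$ treated as indeterminates), let $\bar T$ be obtained from $T$ by multiplying each monomial by the power of $\sum_i\lambda_i$ that makes it homogeneous in $\lambda$ of degree $\deg(T,\lambda)$, and let $\hat T(l,\eta,x,\lambda)=\bar T\big(l,\eta,\tfrac{1-x^2}{1+x^2},\tfrac{2x}{1+x^2},\lambda\big)$. With $\lambda^2=(\lambda_1^2,\dots,\lambda_n^2)$, let $\eta^*$ be the optimal value (infimum)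 of the program $$\inf_{\eta\in\mathbb R,\ \epsilon>0,\ k\in\mathbb N,\ l}\ \eta\quad\text{s.t.}\quad (1+x^2)^{\deg(T,x)}\Big(\hat T(l,\eta,x,\lambda^2)-\epsilon\|\lambda\|_2^{2\deg(T,\lambda)}I\Big)\|\lambda\|_2^{2k}\ \text{ is SOS,}$$ where SOS means being equal to a finite sum $\sum_iG_i^TG_i$ with real matrix polynomials $G_i$ in $(x,\lambda)$. Then $\gamma^*$ is attained by some $l$, it is also the infimum of the constrained form, $\eta^*$ is finite, and $\gamma^*=\sqrt{\eta^*}$. Moreover, a vector $l^*$ is optimal for the min–max problem if and only if it is optimal for the constrained form, and if and only if it is optimal for the SOS program, where $l^*$ is called optimal for either of the last two problems if, with $l=l^*$ fixed, the infimum over the remaining variables equals the optimal value. -/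

import Mathlib

open scoped ENNReal

noncomputable section

namespace ILC

/-- A rational function of the uncertainty vector `lam ∈ ℝⁿ`, without poles on the standard
simplex. -/
structure RatFun (n : ℕ) where
  num : MvPolynomial (Fin n) ℝ
  den : MvPolynomial (Fin n) ℝ
  den_ne_zero : ∀ lam ∈ stdSimplex ℝ (Fin n), MvPolynomial.eval lam den ≠ 0

/-- The value of a rational function. -/
def RatFun.value {n : ℕ} (r : RatFun n) (lam : Fin n → ℝ) : ℝ :=
  MvPolynomial.eval lam r.num / MvPolynomial.eval lam r.den

/-- An uncertain discrete-time plant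
`P(z, lam) = (b_m(lam) z^m + ⋯ + b_0(lam)) / (a_r(lam) z^r + ⋯ + a_0(lam))` with coefficients
rational in `lam`, stable for every `lam` in the standard simplex: all the poles lie in the open
unit disc. A monic denominator is the case `a_r = 1`. -/
structure UncertainPlant (n : ℕ) where
  degNum : ℕ
  degDen : ℕ
  b : Fin (degNum + 1) → RatFun n
  a : Fin (degDen + 1) → RatFun n
  stable : ∀ lam ∈ stdSimplex ℝ (Fin n), ∀ z : ℂ, 1 ≤ ‖z‖ →
    ∑ i, ((a i).value lam : ℂ) * z ^ (i : ℕ) ≠ 0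

/-- The transfer function `P(z, lam)`. -/
def UncertainPlant.transfer {n : ℕ} (P : UncertainPlant n) (z : ℂ) (lam : Fin n → ℝ) : ℂ :=
  (∑ i, ((P.b i).value lam : ℂ) * z ^ (i : ℕ)) / ∑ i, ((P.a i).value lam : ℂ) * z ^ (i : ℕ)

/-- The indices `-k, …, k'` of the coefficients of a non-causal FIR filter. -/
abbrev FIRIndex (k k' : ℕ) : Type := ↥(Finset.Icc (-(k : ℤ)) (k' : ℤ))

/-- The FIR filter `c_{-k} z^k + ⋯ + c_{-1} z + c_0 + c_1 z⁻¹ + ⋯ + c_{k'} z^{-k'}`. -/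
def fir {k k' : ℕ} (c : FIRIndex k k' → ℝ) (z : ℂ) : ℂ :=
  ∑ i, (c i : ℂ) * z ^ (-(i : ℤ))

/-- The map `Q(z) [1 - z L(z) P(z, lam)]` from the error of one trial to that of the next. -/
def errorTransfer {n k₁ k₂ k₃ k₄ : ℕ} (P : UncertainPlant n) (q : FIRIndex k₃ k₄ → ℝ)
    (l : FIRIndex k₁ k₂ → ℝ) (lam : Fin n → ℝ) (z : ℂ) : ℂ :=
  fir q z * (1 - z * fir l z * P.transfer z lam)

/-- The `H∞` norm of a transfer function: the supremum of its modulus on the unit circle. -/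
def hinfNorm (G : ℂ → ℂ) : ℝ≥0∞ :=
  ⨆ z ∈ Metric.sphere (0 : ℂ) 1, ‖G z‖ₑ

/-- The objective `sup_{lam ∈ Λ} ‖Q(z) [1 - z L(z) P(z, lam)]‖_∞` of the min–max problem. -/
def robustRate {n k₁ k₂ k₃ k₄ : ℕ} (P : UncertainPlant n) (q : FIRIndex k₃ k₄ → ℝ)
    (l : FIRIndex k₁ k₂ → ℝ) : ℝ≥0∞ :=
  ⨆ lam ∈ stdSimplex ℝ (Fin n), hinfNorm (errorTransfer P q l lam)

/-- The constraint `γ² - conj(F) F > 0` for all `|z| = 1` and `lam ∈ Λ`, where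
`F = Q(z) [1 - z L(z) P(z, lam)]`. -/
def RateConstraint {n k₁ k₂ k₃ k₄ : ℕ} (P : UncertainPlant n) (q : FIRIndex k₃ k₄ → ℝ)
    (l : FIRIndex k₁ k₂ → ℝ) (γ : ℝ) : Prop :=
  ∀ z : ℂ, ‖z‖ = 1 → ∀ lam ∈ stdSimplex ℝ (Fin n),
    0 < γ ^ 2 - Complex.normSq (errorTransfer P q l lam z)

/-- Polynomials in `(x₁, x₂, lam)` with coefficients in `R`. -/
abbrev XLPoly (n : ℕ) (R : Type) [CommSemiring R] : Type := MvPolynomial (Fin 2 ⊕ Fin n) R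

/-- The point `(x₁, x₂, lam)`. -/
def xlPoint {n : ℕ} (x₁ x₂ : ℝ) (lam : Fin n → ℝ) : Fin 2 ⊕ Fin n → ℝ :=
  Sum.elim ![x₁, x₂] lam

/-- A way of writing, with `z = x₁ + j x₂`,
`Q(z) [1 - z L(z) P(z, lam)] = (ν₁(l, x₁, x₂, lam) + j ν₂(l, x₁, x₂, lam)) / ν₃(x₁, x₂, lam)`
on the unit circle and the simplex: `ν₁, ν₂, ν₃` are real polynomials in `(x₁, x₂, lam)`, the
coefficients of `ν₁` and `ν₂` are polynomials of degree at most one in `l`, and the denominator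
`ν₃` has no zero there. -/
structure FractionForm {n k₃ k₄ : ℕ} (P : UncertainPlant n) (q : FIRIndex k₃ k₄ → ℝ)
    (k₁ k₂ : ℕ) where
  ν₁ : XLPoly n (MvPolynomial (FIRIndex k₁ k₂) ℝ)
  ν₂ : XLPoly n (MvPolynomial (FIRIndex k₁ k₂) ℝ)
  ν₃ : XLPoly n ℝ
  affine₁ : ∀ s, (ν₁.coeff s).totalDegree ≤ 1
  affine₂ : ∀ s, (ν₂.coeff s).totalDegree ≤ 1
  ν₃_ne_zero : ∀ x₁ x₂ : ℝ, x₁ ^ 2 + x₂ ^ 2 = 1 → ∀ lam ∈ stdSimplex ℝ (Fin n),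
    MvPolynomial.eval (xlPoint x₁ x₂ lam) ν₃ ≠ 0
  eq : ∀ (l : FIRIndex k₁ k₂ → ℝ) (x₁ x₂ : ℝ), x₁ ^ 2 + x₂ ^ 2 = 1 →
    ∀ lam ∈ stdSimplex ℝ (Fin n),
      errorTransfer P q l lam (x₁ + x₂ * Complex.I) =
        ((MvPolynomial.eval₂ (MvPolynomial.eval l) (xlPoint x₁ x₂ lam) ν₁ : ℝ) +
          (MvPolynomial.eval₂ (MvPolynomial.eval l) (xlPoint x₁ x₂ lam) ν₂ : ℝ) * Complex.I) /
        (MvPolynomial.eval (xlPoint x₁ x₂ lam) ν₃ : ℝ)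

/-- The degree of a matrix polynomial in `(x₁, x₂)`: the maximum over the entries. -/
def degX {n : ℕ} {R : Type} [CommSemiring R] (M : Matrix (Fin 3) (Fin 3) (XLPoly n R)) : ℕ :=
  Finset.univ.sup fun i => Finset.univ.sup fun j =>
    (M i j).support.sup fun s => ∑ t, s (Sum.inl t)

/-- The degree of a matrix polynomial in `lam`: the maximum over the entries. -/
def degLam {n : ℕ} {R : Type} [CommSemiring R] (M : Matrix (Fin 3) (Fin 3) (XLPoly n R)) : ℕ :=
  Finset.univ.sup fun i => Finset.univ.sup fun j =>
    (M i j).support.sup fun s => ∑ t, s (Sum.inr t)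

/-- Multiply each monomial of `p` by the power of `∑ lam_i` that raises its degree in `lam`
to `d`. -/
def homogenize {n : ℕ} {R : Type} [CommSemiring R] (d : ℕ) (p : XLPoly n R) : XLPoly n R :=
  ∑ s ∈ p.support, MvPolynomial.monomial s (p.coeff s) *
    (∑ i, MvPolynomial.X (Sum.inr i)) ^ (d - ∑ t, s (Sum.inr t))

/-- `hom(M, lam)`: a matrix polynomial, homogeneous in `lam` of degree `degLam M`, that agrees
with `M` on the simplex. -/
def hom {n : ℕ} {R : Type} [CommSemiring R] (M : Matrix (Fin 3) (Fin 3) (XLPoly n R)) :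
    Matrix (Fin 3) (Fin 3) (XLPoly n R) :=
  M.map (homogenize (degLam M))

variable {n k₁ k₂ k₃ k₄ : ℕ} {P : UncertainPlant n} {q : FIRIndex k₃ k₄ → ℝ}

/-- The matrix polynomial `T(l, η, x₁, x₂, lam)`. Its decision variables are indeterminates of
the coefficient ring: `some i` stands for `l_i` and `none` for `η`; so its degrees in `(x₁, x₂)`
and in `lam` do not depend on the values of `l` and `η`. -/
def FractionForm.T (R : FractionForm P q k₁ k₂) :
    Matrix (Fin 3) (Fin 3) (XLPoly n (MvPolynomial (Option (FIRIndex k₁ k₂)) ℝ)) :=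
  let e₁ := MvPolynomial.map (MvPolynomial.rename some).toRingHom R.ν₁
  let e₂ := MvPolynomial.map (MvPolynomial.rename some).toRingHom R.ν₂
  let e₃ := MvPolynomial.map MvPolynomial.C R.ν₃
  !![MvPolynomial.C (MvPolynomial.X none) * e₃ ^ 2, e₁, e₂;
     e₁, 1, 0;
     e₂, 0, 1]

/-- `T̂(l, η, x, lam)`, the value of `hom(T, lam)` at `x₁ = (1 - x²)/(1 + x²)` and
`x₂ = 2x/(1 + x²)`. -/
def FractionForm.THat (R : FractionForm P q k₁ k₂) (l : FIRIndex k₁ k₂ → ℝ) (η x : ℝ)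
    (lam : Fin n → ℝ) : Matrix (Fin 3) (Fin 3) ℝ :=
  (hom R.T).map (MvPolynomial.eval₂ (MvPolynomial.eval fun o => o.elim η l)
    (xlPoint ((1 - x ^ 2) / (1 + x ^ 2)) (2 * x / (1 + x ^ 2)) lam))

/-- A matrix-valued function of `(x, lam)` is SOS if it is a finite sum `∑ G_iᵀ G_i` with matrix
polynomials `G_i` in `(x, lam)`. -/
def IsSOS {n : ℕ} (S : ℝ → (Fin n → ℝ) → Matrix (Fin 3) (Fin 3) ℝ) : Prop :=
  ∃ (N : ℕ) (G : Fin N → Matrix (Fin 3) (Fin 3) (MvPolynomial (Unit ⊕ Fin n) ℝ)),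
    ∀ (x : ℝ) (lam : Fin n → ℝ),
      S x lam = ∑ i, ((G i).map (MvPolynomial.eval (Sum.elim (fun _ => x) lam))).transpose *
        (G i).map (MvPolynomial.eval (Sum.elim (fun _ => x) lam))

/-- The constraint of the SOS program:
`(1 + x²)^deg(T,x) (T̂(l, η, x, lam²) - ε ‖lam‖^(2 deg(T,lam)) I) ‖lam‖^(2k)` is SOS. -/
def FractionForm.SOSConstraint (R : FractionForm P q k₁ k₂) (l : FIRIndex k₁ k₂ → ℝ) (η ε : ℝ)
    (k : ℕ) : Prop :=
  IsSOS fun (x : ℝ) (lam : Fin n → ℝ) =>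
    ((1 + x ^ 2) ^ degX R.T * (∑ i, lam i ^ 2) ^ k) •
      (R.THat l η x (fun i => lam i ^ 2) -
        (ε * (∑ i, lam i ^ 2) ^ degLam R.T) • (1 : Matrix (Fin 3) (Fin 3) ℝ))

end ILC

end

/-!
Fix `l` and let `ρ` be the supremum of `|F_l|` over the product of the unit circle and the simplex.
The plant is stable, so `F_l` is continuous on this compact set and `ρ` is finite; as `F_l` is affine
in `l`, minimizing `ρ` is the approximation of `Q` from a finite-dimensional subspace of a space of
continuous functions, and a minimizer exists (`exists_norm_sub_le`). Everything else follows once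
the feasible `γ`, and the feasible `η` of the SOS program, for this `l` are known to have the infima
`ρ` and `ρ²`; for the SOS program this is `isGLB_SOSConstraint`.

The quadratic form of `T` is `(η ν₃² - ν₁² - ν₂²) v₀² + (v₁ + ν₁ v₀)² + (v₂ + ν₂ v₀)²`, so `T` is
positive definite at a point exactly when `|F_l|² < η` there. A certificate, evaluated at
`(x, √lam)`, gives `T ≥ ε I` on the circle without `-1`, and at `-1` by continuity
(`FractionForm.lt_of_SOSConstraint`). Conversely, let `ρ² < η`, so that `T` is positive definite on
the whole compact set, and let `N = k + deg(T, lam)`. The matrix that multiplies a monomial of degree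
`N` in `(∑ lam_i)^k hom(T - ε I)` is, up to a multinomial coefficient, a Bernstein coefficient of
`T - ε I` (`prod_pow_mul_sum_pow`). Such a coefficient converges to a value of `T` as `N → ∞` and
`ε → 0`, uniformly by compactness, which is Pólya's theorem with parameters
(`eventually_bernstein_pos`). Hence for large `N` all these matrices, cleared of denominators by
`(1 + x²)^deg(T, x)`, are positive definite matrix polynomials in the single variable `x`.

A positive definite matrix polynomial `M` in one variable is a sum of squares
(`exists_sum_mul_self`). By induction on the size, `a M` is a Hermitian square, where `a` is the
upper left entry: it is the square of the first row plus the Schur complement. The factor `a` has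
no real zeros, and it is cancelled one pair of conjugate roots at a time
(`exists_adj_mul_self_of_smul`): if `(X - w)(X - w̄) M = G^* G`, then the columns of `G(w̄)` are
orthogonal to those of `G(w)`, and the Blaschke factor built from the projection onto the span of
the latter turns `G` into a multiple of `X - w` without changing `G^* G` on the real line.
-/

noncomputable section

namespace ILC

/-! ### Positive univariate matrix polynomials are sums of squares -/

open Polynomial Matrix

/-- The polynomial whose value at `x` is the conjugate of the value of `p` at the conjugate of
`x`. -/
def conjPoly : ℂ[X] →+* ℂ[X] := Polynomial.mapRingHom (starRingEnd ℂ)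

/-- The matrix polynomial that is, on the real line, the conjugate transpose of `G`. -/
def adj {m k : Type*} (G : Matrix m k ℂ[X]) : Matrix k m ℂ[X] :=
  (G.map conjPoly).transpose

lemma eval_conjPoly (p : ℂ[X]) (w : ℂ) :
    (conjPoly p).eval w = starRingEnd ℂ (p.eval (starRingEnd ℂ w)) := by
  have := Polynomial.eval_map_apply (f := starRingEnd ℂ) (p := p) (starRingEnd ℂ w)
  simpa [conjPoly] using this

lemma adj_mul {m k o : Type*} [Fintype k] (A : Matrix m k ℂ[X]) (B : Matrix k o ℂ[X]) :
    adj (A * B) = adj B * adj A := by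
  rw [adj, Matrix.map_mul, Matrix.transpose_mul]; rfl

lemma adj_add {m k : Type*} (A B : Matrix m k ℂ[X]) : adj (A + B) = adj A + adj B := by
  ext i j : 1
  simp [adj]

lemma adj_sub {m k : Type*} (A B : Matrix m k ℂ[X]) : adj (A - B) = adj A - adj B := by
  ext i j : 1
  simp [adj]

lemma adj_smul {m k : Type*} (p : ℂ[X]) (A : Matrix m k ℂ[X]) :
    adj (p • A) = conjPoly p • adj A := by
  ext i j : 1
  simp [adj]

lemma adj_map_C {m k : Type*} (A : Matrix m k ℂ) :
    adj (A.map (C : ℂ →+* ℂ[X])) = (A.conjTranspose).map C := by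
  ext i j : 1
  simp [adj, conjPoly]

/-- The orthogonal projection onto the column space of `A`. -/
lemma exists_column_projection {m k : Type*} [Fintype m] [DecidableEq m] [Fintype k]
    (A : Matrix m k ℂ) :
    ∃ (Q : Matrix m m ℂ) (Y : Matrix k m ℂ), Q = A * Y ∧ Q.conjTranspose = Q ∧ Q * A = A := by
  classical
  let f := Matrix.toEuclideanLin A
  let U := LinearMap.range f
  let e := (EuclideanSpace.basisFun m ℂ)
  have hex : ∀ i : m, ∃ y : EuclideanSpace ℂ k, f y = U.starProjection (e i) := fun i =>
    LinearMap.mem_range.mp (Submodule.starProjection_apply_mem U _)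
  choose y hy using hex
  let Q : Matrix m m ℂ := Matrix.of fun i j => U.starProjection (e j) i
  have hQmul : ∀ v : EuclideanSpace ℂ m, Q *ᵥ (v : m → ℂ) = U.starProjection v := by
    intro v
    ext i
    conv_rhs => rw [← e.sum_repr v]
    simp [Q, Matrix.mulVec, dotProduct, e, mul_comm]
  refine ⟨Q, Matrix.of fun i j => y j i, ?_, ?_, ?_⟩
  · ext i j
    simp only [Q, Matrix.of_apply, ← hy]
    simp [f, Matrix.mul_apply, Matrix.toLpLin_apply, Matrix.mulVec, dotProduct]
  · ext i j
    have h := Submodule.inner_starProjection_left_eq_right U (e i) (e j)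
    simpa [Q, e, EuclideanSpace.inner_single_left, EuclideanSpace.inner_single_right] using h
  · ext i j
    have h := hQmul (f (EuclideanSpace.basisFun k ℂ j))
    rw [Submodule.starProjection_eq_self_iff.mpr (LinearMap.mem_range_self f _)] at h
    simpa [f, Matrix.mul_apply, Matrix.toLpLin_apply, Matrix.mulVec, dotProduct] using
      congrFun h i

/-- A nonreal pair of conjugate roots can be cancelled from a Hermitian square. Multiplying `G` by
the Blaschke factor of the projection onto the column space of `G(w)` leaves `G^* G` unchanged on
the real line and makes every entry a multiple of `X - w`; below, `H` is the product without the
denominator `X - w̄` of that factor. -/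
lemma exists_adj_mul_self_of_smul {m k : Type*} [Fintype m] [DecidableEq m] [Fintype k]
    {w : ℂ} (hw : w.im ≠ 0) (M : Matrix k k ℂ[X]) (G : Matrix m k ℂ[X])
    (h : ((X - C (starRingEnd ℂ w)) * (X - C w)) • M = adj G * G) :
    ∃ G' : Matrix m k ℂ[X], M = adj G' * G' := by
  set w' := starRingEnd ℂ w with hw'
  have hne : w' ≠ w := fun hh => hw (Complex.conj_eq_iff_im.mp hh)
  let ev : ℂ → ℂ[X] →+* ℂ := fun z => Polynomial.evalRingHom z
  obtain ⟨Q, Y, hQY, hQ, hQA⟩ := exists_column_projection (G.map (ev w))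
  have hQQ : Q * Q = Q := by
    conv_lhs => rw [hQY]
    conv_rhs => rw [hQY]
    rw [hQY] at hQA
    rw [← Matrix.mul_assoc, hQA]
  have horth : (G.map (ev w)).conjTranspose * G.map (ev w') = 0 := by
    have h1 := congrArg (fun A => A.map (ev w')) h
    have h2 : (adj G).map (ev w') = (G.map (ev w)).conjTranspose := by
      ext i j
      simp [adj, ev, eval_conjPoly, hw']
    rw [← h2, ← Matrix.map_mul]
    refine h1.symm.trans ?_
    ext i j
    simp [ev]
  have hQB : Q * G.map (ev w') = 0 := by
    rw [← hQ, hQY, Matrix.conjTranspose_mul, Matrix.mul_assoc, horth, Matrix.mul_zero]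
  let Qp : Matrix m m ℂ[X] := Q.map C
  have hQp : adj Qp = Qp := by simp only [Qp]; rw [adj_map_C, hQ]
  have hQpQp : Qp * Qp = Qp := by
    simp only [Qp]; rw [← Matrix.map_mul, hQQ]
  let H : Matrix m k ℂ[X] := (X - C w') • (G - Qp * G) + (X - C w) • (Qp * G)
  have hsub : adj (G - Qp * G) = adj G - adj G * Qp := by
    rw [adj_sub, adj_mul, hQp]
  have hHH : adj H * H = ((X - C w') * (X - C w)) • (adj G * G) := by
    have e1 : conjPoly (X - C w') = X - C w := by simp [conjPoly, hw']
    have e2 : conjPoly (X - C w) = X - C w' := by simp [conjPoly, hw']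
    have a1 : (adj G - adj G * Qp) * (Qp * G) = 0 := by
      rw [Matrix.sub_mul, ← Matrix.mul_assoc (adj G * Qp), Matrix.mul_assoc (adj G) Qp Qp, hQpQp,
        Matrix.mul_assoc, sub_self]
    have a2 : adj G * Qp * (G - Qp * G) = 0 := by
      rw [Matrix.mul_sub, ← Matrix.mul_assoc (adj G * Qp), Matrix.mul_assoc (adj G) Qp Qp, hQpQp,
        sub_self]
    have a3 : adj G * Qp * (Qp * G) = adj G * Qp * G := by
      rw [← Matrix.mul_assoc (adj G * Qp), Matrix.mul_assoc (adj G) Qp Qp, hQpQp]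
    have a4 : (adj G - adj G * Qp) * (G - Qp * G) = adj G * G - adj G * Qp * G := by
      rw [Matrix.mul_sub, a1, sub_zero, Matrix.sub_mul]
    simp only [H]
    rw [adj_add, adj_smul, adj_smul, hsub, adj_mul, hQp, e1, e2, Matrix.add_mul, Matrix.mul_add,
      Matrix.mul_add]
    simp only [Matrix.smul_mul, Matrix.mul_smul, a1, a2, a3, a4, smul_zero, add_zero, zero_add,
      smul_smul]
    rw [mul_comm (X - C w) (X - C w'), ← smul_add, sub_add_cancel]
  have hdvd : ∀ i j, (X - C w') * (X - C w) ∣ H i j := by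
    intro i j
    have ent : ∀ z, (H i j).eval z =
        (z - w') * ((G i j).eval z - (Q * G.map (ev z)) i j) + (z - w) * (Q * G.map (ev z)) i j := by
      intro z
      simp [H, Qp, Matrix.mul_apply, ev, Polynomial.eval_finsetSum]
    refine IsCoprime.mul_dvd (Polynomial.isCoprime_X_sub_C_of_isUnit_sub
      (sub_ne_zero.mpr hne).isUnit) ?_ ?_
    · rw [Polynomial.dvd_iff_isRoot, Polynomial.IsRoot, ent, hQB]
      simp
    · rw [Polynomial.dvd_iff_isRoot, Polynomial.IsRoot, ent, hQA]
      simp [ev]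
  choose G' hG' using hdvd
  refine ⟨Matrix.of G', ?_⟩
  set p := (X - C w') * (X - C w) with hp
  have hp0 : p ≠ 0 := mul_ne_zero (X_sub_C_ne_zero _) (X_sub_C_ne_zero _)
  have hpc : conjPoly p = p := by
    simp [hp, conjPoly, hw', mul_comm]
  have hH : H = p • Matrix.of G' := by
    ext i j : 1
    simp [hG']
  rw [hH, adj_smul, hpc, Matrix.smul_mul, Matrix.mul_smul, ← h] at hHH
  ext i j : 1
  have := congrFun (congrFun hHH i) j
  simp only [Matrix.smul_apply, smul_eq_mul] at this
  exact (mul_left_cancel₀ hp0 (mul_left_cancel₀ hp0 this)).symm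

/-- Cancelling a polynomial without real zeros from a Hermitian square, one pair of conjugate
roots at a time. -/
lemma exists_adj_mul_self_of_pos_smul {m k : Type*} [Fintype m] [DecidableEq m] [Fintype k]
    (M : Matrix k k ℝ[X]) (a : ℝ[X]) (ha : ∀ x : ℝ, 0 < a.eval x) (G : Matrix m k ℂ[X])
    (h : (a • M).map (mapRingHom Complex.ofRealHom) = adj G * G) :
    ∃ G' : Matrix m k ℂ[X], M.map (mapRingHom Complex.ofRealHom) = adj G' * G' := by
  induction hd : a.natDegree using Nat.strong_induction_on generalizing a G with
  | _ d ih =>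
    rcases Nat.eq_zero_or_pos d with h0 | hpos
    · subst h0
      obtain ⟨c, rfl⟩ := Polynomial.natDegree_eq_zero.mp hd
      have hc : 0 < c := by simpa using ha 0
      refine ⟨C (((√c)⁻¹ : ℝ) : ℂ) • G, ?_⟩
      have hM : M = C (c⁻¹) • (C c • M) := by
        rw [smul_smul, ← C_mul, inv_mul_cancel₀ hc.ne', C_1, one_smul]
      have e : ∀ N : Matrix k k ℝ[X], (C (c⁻¹) • N).map (mapRingHom Complex.ofRealHom) =
          C ((c⁻¹ : ℝ) : ℂ) • N.map (mapRingHom Complex.ofRealHom) := by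
        intro N
        ext i j : 1
        simp
      rw [hM, e, h, adj_smul, Matrix.smul_mul, Matrix.mul_smul, smul_smul]
      congr 1
      simp only [conjPoly, coe_mapRingHom, map_C, Complex.conj_ofReal, ← C_mul]
      rw [← Complex.ofReal_mul, ← mul_inv, Real.mul_self_sqrt hc.le]
    · obtain ⟨w, hw⟩ := Complex.exists_root (f := a.map Complex.ofRealHom) (by
        rw [Polynomial.degree_map]
        exact Polynomial.natDegree_pos_iff_degree_pos.mp (hd ▸ hpos))
      have hroot : aeval w a = 0 := by
        rw [aeval_def, ← eval_map]; exact hw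
      have him : w.im ≠ 0 := by
        intro hi
        have hwr : w = (w.re : ℂ) := by apply Complex.ext <;> simp [hi]
        rw [hwr] at hroot
        have h2 : aeval ((w.re : ℝ) : ℂ) a = ((a.eval w.re : ℝ) : ℂ) :=
          Polynomial.aeval_algebraMap_apply_eq_algebraMap_eval w.re a
        rw [h2] at hroot
        exact (ha w.re).ne' (by exact_mod_cast hroot)
      obtain ⟨b, hb⟩ := Polynomial.quadratic_dvd_of_aeval_eq_zero_im_ne_zero a hroot him
      have hq : (X ^ 2 - C (2 * w.re) * X + C (‖w‖ ^ 2) : ℝ[X]).map Complex.ofRealHom =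
          (X - C (starRingEnd ℂ w)) * (X - C w) := by
        have h1 : ((2 * w.re : ℝ) : ℂ) = w + starRingEnd ℂ w := by
          rw [Complex.add_conj]
        have h2 : ((‖w‖ ^ 2 : ℝ) : ℂ) = w * starRingEnd ℂ w := by
          rw [Complex.mul_conj, Complex.normSq_eq_norm_sq]
        simp only [Polynomial.map_add, Polynomial.map_sub, Polynomial.map_mul, Polynomial.map_pow,
          map_X, map_C, Complex.ofRealHom_eq_coe]
        rw [h1, h2]
        simp only [C_add, C_mul]
        ring
      have hqpos : ∀ x : ℝ, 0 < (X ^ 2 - C (2 * w.re) * X + C (‖w‖ ^ 2) : ℝ[X]).eval x := by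
        intro x
        have : ‖w‖ ^ 2 = w.re ^ 2 + w.im ^ 2 := by
          rw [← Complex.normSq_eq_norm_sq, Complex.normSq_apply]; ring
        simp only [eval_add, eval_sub, eval_pow, eval_X, eval_mul, eval_C, this]
        have := sq_nonneg (x - w.re)
        have := pow_pos (abs_pos.mpr him) 2
        rw [sq_abs] at this
        nlinarith
      have hbpos : ∀ x : ℝ, 0 < b.eval x := by
        intro x
        have h1 := ha x
        rw [hb, eval_mul] at h1
        exact pos_of_mul_pos_right h1 (hqpos x).le
      have hb0 : b ≠ 0 := by
        rintro rfl
        simpa using hbpos 0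
      have hq0 : (X ^ 2 - C (2 * w.re) * X + C (‖w‖ ^ 2) : ℝ[X]) ≠ 0 := by
        intro h0
        have := hqpos 0
        rw [h0] at this
        simp at this
      have hqd : (X ^ 2 - C (2 * w.re) * X + C (‖w‖ ^ 2) : ℝ[X]).natDegree = 2 := by
        compute_degree!
      have hbd : b.natDegree < d := by
        rw [← hd, hb, natDegree_mul hq0 hb0, hqd]; omega
      have hbM : ((X - C (starRingEnd ℂ w)) * (X - C w)) •
          (b • M).map (mapRingHom Complex.ofRealHom) = adj G * G := by
        rw [← h, ← hq, hb]
        ext i j : 1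
        simp [mul_assoc]
      obtain ⟨G₁, hG₁⟩ := exists_adj_mul_self_of_smul him _ G hbM
      exact ih _ hbd b hbpos G₁ hG₁ rfl

/-- A matrix polynomial in one variable that is positive definite on the real line is a Hermitian
square. Induction on the size: with `a` the upper left entry, `a M` is the square of the first row
plus the Schur complement, and `a` cancels. -/
theorem exists_adj_mul_self {k : ℕ} (M : Matrix (Fin k) (Fin k) ℝ[X])
    (hsymm : ∀ i j, M i j = M j i)
    (hpos : ∀ (x : ℝ) (v : Fin k → ℝ), v ≠ 0 → 0 < ∑ i, ∑ j, v i * (M i j).eval x * v j) :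
    ∃ (N : ℕ) (G : Matrix (Fin N) (Fin k) ℂ[X]),
      M.map (mapRingHom Complex.ofRealHom) = adj G * G := by
  induction k with
  | zero => exact ⟨0, 0, by ext i; exact i.elim0⟩
  | succ k ih =>
    set a := M 0 0 with ha_def
    have ha : ∀ x, 0 < a.eval x := by
      intro x
      have h := hpos x (Pi.single 0 1) (by simp)
      simpa [Fin.sum_univ_succ, Pi.single_apply, Fin.succ_ne_zero] using h
    let S : Matrix (Fin k) (Fin k) ℝ[X] :=
      Matrix.of fun i j => a * M i.succ j.succ - M 0 i.succ * M 0 j.succ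
    obtain ⟨N, G, hG⟩ := ih S (fun i j => by simp [S, hsymm i.succ j.succ, mul_comm]) (by
      intro x v hv
      let β : ℝ := ∑ j, (M 0 j.succ).eval x * v j
      let u : Fin (k + 1) → ℝ := Fin.cons (-β / a.eval x) v
      have hu : u ≠ 0 := by
        intro h0
        exact hv (funext fun i => by simpa [u] using congrFun h0 i.succ)
      have h := mul_pos (ha x) (hpos x u hu)
      have hform : ∑ i, ∑ j, v i * (S i j).eval x * v j =
          a.eval x * (∑ i : Fin k, ∑ j : Fin k, v i * (M i.succ j.succ).eval x * v j) - β * β := by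
        simp only [β]
        rw [Finset.sum_mul_sum, Finset.mul_sum, ← Finset.sum_sub_distrib]
        refine Finset.sum_congr rfl fun i _ => ?_
        rw [Finset.mul_sum, ← Finset.sum_sub_distrib]
        refine Finset.sum_congr rfl fun j _ => ?_
        simp [S]
        ring
      rw [hform]
      refine lt_of_lt_of_eq h ?_
      have e1 : ∑ i : Fin k, v i * (M i.succ 0).eval x * (-β / a.eval x) =
          β * (-β / a.eval x) := by
        simp only [β]
        rw [Finset.sum_mul]
        refine Finset.sum_congr rfl fun i _ => ?_
        rw [hsymm i.succ 0]; ring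
      have e2 : ∑ j : Fin k, (-β / a.eval x) * (M 0 j.succ).eval x * v j =
          (-β / a.eval x) * β := by
        simp only [β]
        rw [Finset.mul_sum]
        exact Finset.sum_congr rfl fun i _ => by ring
      simp only [Fin.sum_univ_succ, u, Fin.cons_zero, Fin.cons_succ, Finset.sum_add_distrib]
      rw [e1, e2, ← ha_def]
      have := (ha x).ne'
      field_simp
      ring)
    refine ⟨N + 1, ?_⟩
    let H : Matrix (Fin (N + 1)) (Fin (k + 1)) ℂ[X] :=
      Matrix.of (Fin.cons (fun j => (M 0 j).map Complex.ofRealHom)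
        (fun r => Fin.cons 0 (G r)))
    refine exists_adj_mul_self_of_pos_smul M a ha H ?_
    have hreal : ∀ p : ℝ[X], conjPoly (p.map Complex.ofRealHom) = p.map Complex.ofRealHom := by
      intro p
      ext n
      simp [conjPoly]
    have hGe : ∀ i j, (S i j).map Complex.ofRealHom = ∑ r, conjPoly (G r i) * G r j := by
      intro i j
      have := congrFun (congrFun hG i) j
      simpa [adj, Matrix.mul_apply] using this
    ext i j : 1
    simp only [Matrix.map_apply, Matrix.smul_apply, smul_eq_mul, adj, Matrix.mul_apply,
      Matrix.transpose_apply, Fin.sum_univ_succ, coe_mapRingHom]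
    simp only [H, Matrix.of_apply, Fin.cons_zero, Fin.cons_succ, hreal]
    refine Fin.cases ?_ (fun i => ?_) i
    · simp [← ha_def]
    · refine Fin.cases ?_ (fun j => ?_) j
      · simp [← ha_def, hsymm i.succ 0, mul_comm]
      · simp only [Fin.cons_succ, ← hGe]
        rw [← Polynomial.map_mul, ← Polynomial.map_add]
        simp [S]

/-- A matrix polynomial in one variable that is positive definite on the real line is a sum of
squares of real row vectors of polynomials. -/
theorem exists_sum_mul_self {k : ℕ} (M : Matrix (Fin k) (Fin k) ℝ[X])
    (hsymm : ∀ i j, M i j = M j i)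
    (hpos : ∀ (x : ℝ) (v : Fin k → ℝ), v ≠ 0 → 0 < ∑ i, ∑ j, v i * (M i j).eval x * v j) :
    ∃ (N : ℕ) (g : Fin N × Bool → Fin k → ℝ[X]),
      ∀ i j x, (M i j).eval x = ∑ r, (g r i).eval x * (g r j).eval x := by
  obtain ⟨N, G, hG⟩ := exists_adj_mul_self M hsymm hpos
  have hri : ∀ p : ℂ[X], ∃ a b : ℝ[X], ∀ x : ℝ, p.eval (x : ℂ) = ⟨a.eval x, b.eval x⟩ := by
    intro p
    induction p using Polynomial.induction_on' with
    | add p q hp hq =>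
      obtain ⟨a, b, h⟩ := hp
      obtain ⟨a', b', h'⟩ := hq
      exact ⟨a + a', b + b', fun x => by rw [eval_add, h, h']; apply Complex.ext <;> simp⟩
    | monomial n c =>
      refine ⟨monomial n c.re, monomial n c.im, fun x => ?_⟩
      rw [eval_monomial, eval_monomial, eval_monomial, ← Complex.ofReal_pow]
      apply Complex.ext
      · rw [Complex.re_mul_ofReal]
      · rw [Complex.im_mul_ofReal]
  choose re im hre using hri
  refine ⟨N, fun r i => if r.2 then re (G r.1 i) else im (G r.1 i), fun i j x => ?_⟩
  have h := congrArg (fun p : ℂ[X] => (p.eval (x : ℂ)).re) (congrFun (congrFun hG i) j)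
  simp only [Matrix.map_apply, coe_mapRingHom, adj, Matrix.mul_apply, Matrix.transpose_apply,
    eval_finsetSum, eval_mul, eval_conjPoly, Complex.conj_ofReal, Complex.re_sum] at h
  have hl : (eval (x : ℂ) ((M i j).map Complex.ofRealHom)).re = (M i j).eval x := by
    have := Polynomial.eval_map_apply (f := Complex.ofRealHom) (p := M i j) x
    simp only [Complex.ofRealHom_eq_coe] at this
    rw [this, Complex.ofReal_re]
  rw [hl] at h
  rw [h, Fintype.sum_prod_type]
  refine Finset.sum_congr rfl fun r _ => ?_
  simp [hre]

end ILC

namespace ILC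

/-! ### Bernstein coefficients on the simplex -/

open Filter Topology

/-- For `t = α / N` and `u = 1 / N`, the coefficient of the monomial `lam ^ β` in the Bernstein
basis of degree `N`, at the multi-index `α`. It tends to `t ^ β` as `u → 0`. -/
def bernsteinWeight {n : ℕ} (β : Fin n → ℕ) (t : Fin n → ℝ) (u : ℝ) : ℝ :=
  (∏ i, ∏ j ∈ Finset.range (β i), (t i - j * u)) / ∏ j ∈ Finset.range (∑ i, β i), (1 - j * u)

lemma bernsteinWeight_zero_left {n : ℕ} (t : Fin n → ℝ) (u : ℝ) :
    bernsteinWeight (0 : Fin n → ℕ) t u = 1 := by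
  simp [bernsteinWeight]

lemma bernsteinWeight_zero_right {n : ℕ} (β : Fin n → ℕ) (t : Fin n → ℝ) :
    bernsteinWeight β t 0 = ∏ i, t i ^ β i := by
  simp [bernsteinWeight]

lemma continuousAt_bernsteinWeight {n : ℕ} (β : Fin n → ℕ) (t : Fin n → ℝ) :
    ContinuousAt (fun p : (Fin n → ℝ) × ℝ => bernsteinWeight β p.1 p.2) (t, 0) := by
  unfold bernsteinWeight
  refine ContinuousAt.div ?_ ?_ ?_
  · exact Continuous.continuousAt (by fun_prop)
  · exact Continuous.continuousAt (by fun_prop)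
  · simp

lemma prod_range_sub_div (a k : ℕ) (hk : k ≤ a) (N : ℝ) :
    ((a - k).factorial : ℝ) * ∏ j ∈ Finset.range k, ((a : ℝ) / N - j * (1 / N)) =
      a.factorial / N ^ k := by
  have h1 : ∏ j ∈ Finset.range k, ((a : ℝ) / N - j * (1 / N)) =
      (a.descFactorial k : ℝ) / N ^ k := by
    rw [Nat.descFactorial_eq_prod_range, Nat.cast_prod, ← Finset.card_range k,
      ← Finset.prod_const, Finset.card_range, ← Finset.prod_div_distrib]
    refine Finset.prod_congr rfl fun j hj => ?_
    rw [Nat.cast_sub (by have := Finset.mem_range.mp hj; omega)]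
    ring
  rw [h1, ← Nat.factorial_mul_descFactorial hk]
  push_cast
  ring

lemma multinomial_mul_bernsteinWeight {n : ℕ} (β γ : Fin n → ℕ) (N : ℕ)
    (h : ∑ i, (β i + γ i) = N) (hN : 0 < N) :
    (Nat.multinomial Finset.univ (β + γ) : ℝ) *
      bernsteinWeight β (fun i => ((β i + γ i : ℕ) : ℝ) / N) (1 / N) =
      Nat.multinomial Finset.univ γ := by
  have hN' : (N : ℝ) ≠ 0 := by positivity
  have hsum : ∑ i, γ i = N - ∑ i, β i := by
    rw [← h, Finset.sum_add_distrib]; omega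
  have hle : ∑ i, β i ≤ N := by rw [← h, Finset.sum_add_distrib]; omega
  have s1 : (∏ i, ((β i + γ i).factorial : ℝ)) * Nat.multinomial Finset.univ (β + γ) =
      N.factorial := by
    have := Nat.multinomial_spec Finset.univ (β + γ)
    simp only [Pi.add_apply, h] at this
    exact_mod_cast this
  have s2 : (∏ i, ((γ i).factorial : ℝ)) * Nat.multinomial Finset.univ γ =
      (N - ∑ i, β i).factorial := by
    have := Nat.multinomial_spec Finset.univ γ
    rw [hsum] at this
    exact_mod_cast this
  have s3 : (∏ i, ((γ i).factorial : ℝ)) *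
      ∏ i, ∏ j ∈ Finset.range (β i), (((β i + γ i : ℕ) : ℝ) / N - j * (1 / N)) =
      (∏ i, ((β i + γ i).factorial : ℝ)) / (N : ℝ) ^ ∑ i, β i := by
    rw [← Finset.prod_pow_eq_pow_sum, ← Finset.prod_div_distrib, ← Finset.prod_mul_distrib]
    refine Finset.prod_congr rfl fun i _ => ?_
    have := prod_range_sub_div (β i + γ i) (β i) (by omega) N
    rwa [Nat.add_sub_cancel_left] at this
  have s4 := prod_range_sub_div N (∑ i, β i) hle N
  rw [div_self hN'] at s4
  have hf : ∀ m : ℕ, (m.factorial : ℝ) ≠ 0 := fun m => by positivity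
  have p1 : (∏ i, ((γ i).factorial : ℝ)) ≠ 0 := Finset.prod_ne_zero_iff.mpr fun i _ => hf _
  have p2 : (∏ i, ((β i + γ i).factorial : ℝ)) ≠ 0 := Finset.prod_ne_zero_iff.mpr fun i _ => hf _
  have hpow : (N : ℝ) ^ ∑ i, β i ≠ 0 := pow_ne_zero _ hN'
  unfold bernsteinWeight
  set A := ∏ i, ∏ j ∈ Finset.range (β i), (((β i + γ i : ℕ) : ℝ) / N - j * (1 / N))
  set B := ∏ j ∈ Finset.range (∑ i, β i), (1 - (j : ℝ) * (1 / N))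
  have hB : B ≠ 0 := by
    intro h0
    rw [h0, mul_zero] at s4
    exact div_ne_zero (hf N) hpow s4.symm
  have e1 : (Nat.multinomial Finset.univ (β + γ) : ℝ) =
      N.factorial / ∏ i, ((β i + γ i).factorial : ℝ) := by
    rw [eq_div_iff p2, ← s1]; ring
  have e2 : (Nat.multinomial Finset.univ γ : ℝ) =
      (N - ∑ i, β i).factorial / ∏ i, ((γ i).factorial : ℝ) := by
    rw [eq_div_iff p1, ← s2]; ring
  have e3 : A = (∏ i, ((β i + γ i).factorial : ℝ)) / (N : ℝ) ^ (∑ i, β i) /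
      ∏ i, ((γ i).factorial : ℝ) := by
    rw [eq_div_iff p1, ← s3]; ring
  have e4 : B = N.factorial / (N : ℝ) ^ (∑ i, β i) / (N - ∑ i, β i).factorial := by
    rw [eq_div_iff (hf _), ← s4]; ring
  rw [e1, e2, e3, e4]
  have := hf N
  have := hf (N - ∑ i, β i)
  field_simp

/-- The expansion of a monomial, homogenized to degree `N`, in the Bernstein basis. -/
lemma prod_pow_mul_sum_pow {n : ℕ} (β : Fin n → ℕ) (N : ℕ) (hN : 0 < N) (hβ : ∑ i, β i ≤ N)
    (z : Fin n → ℝ) :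
    (∏ i, z i ^ β i) * (∑ i, z i) ^ (N - ∑ i, β i) =
      ∑ α ∈ Finset.piAntidiag Finset.univ N, (Nat.multinomial Finset.univ α : ℝ) *
        bernsteinWeight β (fun i => (α i : ℝ) / N) (1 / N) * ∏ i, z i ^ α i := by
  rw [Finset.sum_pow_eq_sum_piAntidiag, Finset.mul_sum]
  refine Finset.sum_of_injOn (fun γ => β + γ) (fun _ _ _ _ h => add_left_cancel h) ?_ ?_ ?_
  · intro γ hγ
    rw [Finset.mem_coe, Finset.mem_piAntidiag] at hγ ⊢
    have hγ1 : ∑ i, γ i = N - ∑ i, β i := hγ.1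
    refine ⟨?_, by simp⟩
    change ∑ i, (β i + γ i) = N
    rw [Finset.sum_add_distrib]
    omega
  · intro α hα hα'
    have hα1 : ∑ i, α i = N := (Finset.mem_piAntidiag.mp hα).1
    have : ∃ i, α i < β i := by
      by_contra! hle
      refine hα' ⟨α - β, ?_, ?_⟩
      · simp only [Finset.mem_coe, Finset.mem_piAntidiag]
        refine ⟨?_, by simp⟩
        have : ∑ i, α i = ∑ i, β i + ∑ i, (α - β) i := by
          rw [← Finset.sum_add_distrib]
          exact Finset.sum_congr rfl fun i _ => by have := hle i; simp only [Pi.sub_apply]; omega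
        change ∑ i, (α - β) i = _
        omega
      · ext i
        have := hle i
        simp only [Pi.add_apply, Pi.sub_apply]; omega
    obtain ⟨i, hi⟩ := this
    have h0 : bernsteinWeight β (fun i => (α i : ℝ) / N) (1 / N) = 0 := by
      unfold bernsteinWeight
      rw [Finset.prod_eq_zero (Finset.mem_univ i), zero_div]
      exact Finset.prod_eq_zero (Finset.mem_range.mpr hi) (by ring)
    rw [h0, mul_zero, zero_mul]
  · intro γ hγ
    have hγ1 : ∑ i, γ i = N - ∑ i, β i := (Finset.mem_piAntidiag.mp hγ).1
    have := multinomial_mul_bernsteinWeight β γ N (by rw [Finset.sum_add_distrib]; omega) hN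
    simp only [Pi.add_apply, pow_add, Finset.prod_mul_distrib]
    rw [this]
    ring

/-- Pólya's theorem, uniformly in parameters from a compact set: the Bernstein coefficients
approach the values of the polynomial. -/
lemma eventually_bernstein_pos {n : ℕ} {Y ι : Type*} [TopologicalSpace Y] {K : Set Y}
    (hK : IsCompact K) (B : Finset ι) (β : ι → Fin n → ℕ) (c : ι → Y → ℝ)
    (hc : ∀ s, Continuous (c s))
    (hpos : ∀ y ∈ K, ∀ t ∈ stdSimplex ℝ (Fin n), 0 < ∑ s ∈ B, c s y * ∏ i, t i ^ β s i) :
    ∀ᶠ p : ℝ × ℝ in 𝓝 0, ∀ y ∈ K, ∀ t ∈ stdSimplex ℝ (Fin n),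
      0 < ∑ s ∈ B, c s y * bernsteinWeight (β s) t p.1 - p.2 := by
  have h : ∀ᶠ p : ℝ × ℝ in 𝓝 0, ∀ z ∈ K ×ˢ stdSimplex ℝ (Fin n),
      0 < ∑ s ∈ B, c s z.1 * bernsteinWeight (β s) z.2 p.1 - p.2 := by
    refine (hK.prod (isCompact_stdSimplex ℝ (Fin n))).eventually_forall_of_forall_eventually ?_
    rintro ⟨y, t⟩ ⟨hy, ht⟩
    have hcont : ContinuousAt (fun q : (ℝ × ℝ) × (Y × (Fin n → ℝ)) =>
        ∑ s ∈ B, c s q.2.1 * bernsteinWeight (β s) q.2.2 q.1.1 - q.1.2) (0, (y, t)) := by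
      refine ContinuousAt.sub (tendsto_finsetSum _ fun s _ => ?_)
        (Continuous.continuousAt (by fun_prop))
      refine ContinuousAt.mul (((hc s).comp (by fun_prop)).continuousAt) ?_
      exact (continuousAt_bernsteinWeight (β s) t).comp_of_eq
        (f := fun q : (ℝ × ℝ) × (Y × (Fin n → ℝ)) => (q.2.2, q.1.1))
        (Continuous.continuousAt (by fun_prop)) rfl
    refine hcont.eventually (lt_mem_nhds ?_)
    simpa [bernsteinWeight_zero_right] using hpos y hy t ht
  exact h.mono fun p hp y hy t ht => hp (y, t) ⟨hy, ht⟩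

end ILC

namespace ILC

/-! ### SOS certificates for positive definite matrix polynomials -/

open Filter Topology MvPolynomial

lemma isSOS_of_rows {n : ℕ} {S : ℝ → (Fin n → ℝ) → Matrix (Fin 3) (Fin 3) ℝ} {ι : Type*}
    [Fintype ι] (g : ι → Fin 3 → MvPolynomial (Unit ⊕ Fin n) ℝ)
    (h : ∀ x lam i j, S x lam i j = ∑ r, eval (Sum.elim (fun _ => x) lam) (g r i) *
      eval (Sum.elim (fun _ => x) lam) (g r j)) : IsSOS S := by
  refine ⟨Fintype.card ι, fun r => Matrix.of fun a i =>
    if a = 0 then g ((Fintype.equivFin ι).symm r) i else 0, fun x lam => ?_⟩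
  ext i j
  rw [h, Matrix.sum_apply, ← (Fintype.equivFin ι).symm.sum_comp]
  refine Finset.sum_congr rfl fun r _ => ?_
  simp [Matrix.mul_apply, Fin.sum_univ_succ]

lemma eval₂_xlPoint {n : ℕ} {A : Type} [CommSemiring A] (f : A →+* ℝ) (p : XLPoly n A)
    (U : Finset (Fin 2 ⊕ Fin n →₀ ℕ)) (hU : p.support ⊆ U) (x₁ x₂ : ℝ) (lam : Fin n → ℝ) :
    eval₂ f (xlPoint x₁ x₂ lam) p = ∑ s ∈ U, f (p.coeff s) *
      (x₁ ^ s (Sum.inl 0) * x₂ ^ s (Sum.inl 1)) * ∏ i, lam i ^ s (Sum.inr i) := by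
  rw [eval₂_eq']
  refine Finset.sum_subset_zero_on_sdiff hU (fun s hs => ?_) (fun s _ => ?_)
  · have : p.coeff s = 0 := notMem_support_iff.mp (Finset.mem_sdiff.mp hs).2
    simp [this]
  · simp [Fintype.prod_sum_type, xlPoint, mul_assoc]

lemma eval₂_xlPoint_homogenize {n : ℕ} {A : Type} [CommSemiring A] (f : A →+* ℝ) (d : ℕ)
    (p : XLPoly n A) (U : Finset (Fin 2 ⊕ Fin n →₀ ℕ)) (hU : p.support ⊆ U) (x₁ x₂ : ℝ)
    (lam : Fin n → ℝ) :
    eval₂ f (xlPoint x₁ x₂ lam) (homogenize d p) = ∑ s ∈ U, f (p.coeff s) *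
      (x₁ ^ s (Sum.inl 0) * x₂ ^ s (Sum.inl 1)) * ((∏ i, lam i ^ s (Sum.inr i)) *
        (∑ i, lam i) ^ (d - ∑ t, s (Sum.inr t))) := by
  rw [homogenize, eval₂_sum]
  refine Finset.sum_subset_zero_on_sdiff hU (fun s hs => ?_) (fun s _ => ?_)
  · have : p.coeff s = 0 := notMem_support_iff.mp (Finset.mem_sdiff.mp hs).2
    simp [this]
  · rw [eval₂_mul, eval₂_pow, eval₂_sum, eval₂_monomial,
      Finsupp.prod_fintype _ _ (fun _ => pow_zero _)]
    simp [Fintype.prod_sum_type, xlPoint, mul_assoc]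

/-- Homogenizing in `lam` does not change the values on the simplex. -/
lemma eval₂_homogenize_of_mem_stdSimplex {n : ℕ} {A : Type} [CommSemiring A] (f : A →+* ℝ) (d : ℕ)
    (p : XLPoly n A) (x₁ x₂ : ℝ) {lam : Fin n → ℝ} (hlam : lam ∈ stdSimplex ℝ (Fin n)) :
    eval₂ f (xlPoint x₁ x₂ lam) (homogenize d p) = eval₂ f (xlPoint x₁ x₂ lam) p := by
  rw [eval₂_xlPoint_homogenize f d p _ subset_rfl, eval₂_xlPoint f p _ subset_rfl]
  simp [hlam.2]

lemma exists_mul_sq_sum_eq_one {v : Fin 3 → ℝ} (hv : v ≠ 0) :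
    ∃ r : ℝ, 0 < r ∧ ∃ u : Fin 3 → ℝ, ∑ i, u i ^ 2 = 1 ∧ v = fun i => r * u i := by
  have hpos : 0 < ∑ i, v i ^ 2 := by
    obtain ⟨i, hi⟩ := Function.ne_iff.mp hv
    exact Finset.sum_pos' (fun i _ => sq_nonneg _) ⟨i, Finset.mem_univ i, by
      have : v i ≠ 0 := hi
      positivity⟩
  have hr := Real.sqrt_pos.mpr hpos
  refine ⟨√(∑ i, v i ^ 2), hr, fun i => v i / √(∑ i, v i ^ 2), ?_, ?_⟩
  · simp only [div_pow, ← Finset.sum_div]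
    rw [Real.sq_sqrt hpos.le, div_self hpos.ne']
  · ext i
    field_simp

lemma isCompact_circle_prod_sphere :
    IsCompact ({y : ℝ × ℝ | y.1 ^ 2 + y.2 ^ 2 = 1} ×ˢ {v : Fin 3 → ℝ | ∑ i, v i ^ 2 = 1}) := by
  refine IsCompact.prod ?_ ?_
  · refine Metric.isCompact_of_isClosed_isBounded
      (isClosed_eq (by fun_prop) continuous_const)
      ((Metric.isBounded_closedBall (x := (0 : ℝ × ℝ)) (r := 1)).subset ?_)
    intro y hy
    have hy' : y.1 ^ 2 + y.2 ^ 2 = 1 := hy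
    rw [mem_closedBall_zero_iff, Prod.norm_def, max_le_iff, Real.norm_eq_abs, Real.norm_eq_abs]
    exact ⟨abs_le_one_iff_mul_self_le_one.mpr (by nlinarith [sq_nonneg y.2]),
      abs_le_one_iff_mul_self_le_one.mpr (by nlinarith [sq_nonneg y.1])⟩
  · refine Metric.isCompact_of_isClosed_isBounded
      (isClosed_eq (by fun_prop) continuous_const)
      ((Metric.isBounded_closedBall (x := (0 : Fin 3 → ℝ)) (r := 1)).subset ?_)
    intro v hv
    have hv' : ∑ i, v i ^ 2 = 1 := hv
    rw [mem_closedBall_zero_iff, pi_norm_le_iff_of_nonneg zero_le_one]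
    intro i
    rw [Real.norm_eq_abs]
    refine abs_le_one_iff_mul_self_le_one.mpr ?_
    rw [← hv', ← sq]
    exact Finset.single_le_sum (f := fun i => v i ^ 2) (fun i _ => sq_nonneg _) (Finset.mem_univ i)

lemma rational_circle_point (x : ℝ) :
    ((1 - x ^ 2) / (1 + x ^ 2)) ^ 2 + (2 * x / (1 + x ^ 2)) ^ 2 = 1 := by
  have : 1 + x ^ 2 ≠ 0 := by positivity
  field_simp
  ring

/-- A symmetric matrix polynomial that is positive definite on the product of the circle and the
simplex has an SOS certificate: for a large power of `‖lam‖²` the coefficients of the monomials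
in `lam²` are positive definite matrix polynomials in `x`, and these are sums of squares. -/
theorem exists_isSOS_of_posDef {n : ℕ} {A : Type} [CommSemiring A] (f : A →+* ℝ)
    (T : Matrix (Fin 3) (Fin 3) (XLPoly n A)) (hsymm : ∀ i j, T i j = T j i)
    (hpos : ∀ x₁ x₂ : ℝ, x₁ ^ 2 + x₂ ^ 2 = 1 → ∀ lam ∈ stdSimplex ℝ (Fin n),
      ∀ v : Fin 3 → ℝ, v ≠ 0 →
        0 < ∑ i, ∑ j, v i * eval₂ f (xlPoint x₁ x₂ lam) (T i j) * v j) :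
    ∃ (ε : ℝ) (k : ℕ), 0 < ε ∧ IsSOS fun (x : ℝ) (lam : Fin n → ℝ) =>
      ((1 + x ^ 2) ^ degX T * (∑ i, lam i ^ 2) ^ k) •
        ((hom T).map (eval₂ f (xlPoint ((1 - x ^ 2) / (1 + x ^ 2)) (2 * x / (1 + x ^ 2))
          (fun i => lam i ^ 2))) -
          (ε * (∑ i, lam i ^ 2) ^ degLam T) • (1 : Matrix (Fin 3) (Fin 3) ℝ)) := by
  classical
  set D := degX T with hD
  set d := degLam T with hd
  let U : Finset (Fin 2 ⊕ Fin n →₀ ℕ) :=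
    Finset.univ.biUnion fun i => Finset.univ.biUnion fun j => (T i j).support
  have hU : ∀ i j, (T i j).support ⊆ U := fun i j s hs => by
    simp only [U, Finset.mem_biUnion, Finset.mem_univ, true_and]
    exact ⟨i, j, hs⟩
  have hUD : ∀ s ∈ U, s (Sum.inl 0) + s (Sum.inl 1) ≤ D := fun s hs => by
    simp only [U, Finset.mem_biUnion, Finset.mem_univ, true_and] at hs
    obtain ⟨i, j, hs⟩ := hs
    have h1 : ∑ t, s (Sum.inl t) ≤ D :=
      (Finset.le_sup (f := fun s : Fin 2 ⊕ Fin n →₀ ℕ => ∑ t, s (Sum.inl t)) hs).trans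
        ((Finset.le_sup (f := fun j => (T i j).support.sup fun s => ∑ t, s (Sum.inl t))
          (Finset.mem_univ j)).trans (Finset.le_sup (f := fun i => Finset.univ.sup fun j =>
            (T i j).support.sup fun s => ∑ t, s (Sum.inl t)) (Finset.mem_univ i)))
    simpa using h1
  have hUd : ∀ s ∈ U, ∑ t, s (Sum.inr t) ≤ d := fun s hs => by
    simp only [U, Finset.mem_biUnion, Finset.mem_univ, true_and] at hs
    obtain ⟨i, j, hs⟩ := hs
    exact (Finset.le_sup (f := fun s : Fin 2 ⊕ Fin n →₀ ℕ => ∑ t, s (Sum.inr t)) hs).trans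
      ((Finset.le_sup (f := fun j => (T i j).support.sup fun s => ∑ t, s (Sum.inr t))
        (Finset.mem_univ j)).trans (Finset.le_sup (f := fun i => Finset.univ.sup fun j =>
          (T i j).support.sup fun s => ∑ t, s (Sum.inr t)) (Finset.mem_univ i)))
  let β : (Fin 2 ⊕ Fin n →₀ ℕ) → Fin n → ℕ := fun s i => s (Sum.inr i)
  let c : (Fin 2 ⊕ Fin n →₀ ℕ) → (ℝ × ℝ) × (Fin 3 → ℝ) → ℝ := fun s y =>
    ∑ i, ∑ j, y.2 i * (f ((T i j).coeff s) * (y.1.1 ^ s (Sum.inl 0) * y.1.2 ^ s (Sum.inl 1))) *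
      y.2 j
  -- the quadratic form of a combination of the coefficients of the entries
  have hswap : ∀ (y : (ℝ × ℝ) × (Fin 3 → ℝ)) (w : (Fin 2 ⊕ Fin n →₀ ℕ) → ℝ),
      ∑ s ∈ U, c s y * w s = ∑ i, ∑ j, y.2 i * (∑ s ∈ U, f ((T i j).coeff s) *
        (y.1.1 ^ s (Sum.inl 0) * y.1.2 ^ s (Sum.inl 1)) * w s) * y.2 j := by
    intro y w
    simp only [c, Finset.sum_mul, Finset.mul_sum]
    rw [Finset.sum_comm]
    refine Finset.sum_congr rfl fun i _ => ?_
    rw [Finset.sum_comm]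
    refine Finset.sum_congr rfl fun j _ => Finset.sum_congr rfl fun s _ => ?_
    ring
  have hev := eventually_bernstein_pos isCompact_circle_prod_sphere U β c
    (fun s => by simp only [c]; fun_prop) (by
      rintro ⟨⟨x₁, x₂⟩, v⟩ ⟨hx, hv⟩ t ht
      rw [hswap]
      have hv' : ∑ i, v i ^ 2 = 1 := hv
      have h := hpos x₁ x₂ hx t ht v (by rintro rfl; simp at hv')
      simpa only [eval₂_xlPoint f (T _ _) U (hU _ _)] using h)
  have hseq : Tendsto (fun m : ℕ => ((1 / ((m : ℝ) + 1), 1 / ((m : ℝ) + 1)) : ℝ × ℝ)) atTop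
      (𝓝 0) :=
    (tendsto_one_div_add_atTop_nhds_zero_nat (𝕜 := ℝ)).prodMk_nhds
      (tendsto_one_div_add_atTop_nhds_zero_nat (𝕜 := ℝ))
  obtain ⟨m, hm, hmd⟩ := ((hseq.eventually hev).and (eventually_ge_atTop d)).exists
  set N := m + 1 with hN
  have hNd : d ≤ N := by omega
  have hN0 : 0 < N := by omega
  have hNc : ((m : ℝ) + 1) = (N : ℝ) := by push_cast [hN]; rfl
  rw [hNc] at hm
  set ε : ℝ := 1 / (N : ℝ) with hε
  have hε0 : 0 < ε := by positivity
  -- the matrix polynomial in `x` that multiplies the monomial of multi-index `α`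
  let M : (Fin n → ℕ) → Matrix (Fin 3) (Fin 3) (Polynomial ℝ) := fun α => Matrix.of fun i j =>
    ∑ s ∈ U, Polynomial.C (f ((T i j).coeff s) *
        bernsteinWeight (β s) (fun i => (α i : ℝ) / N) (1 / N)) *
      ((1 - Polynomial.X ^ 2) ^ s (Sum.inl 0) * (2 * Polynomial.X) ^ s (Sum.inl 1) *
        (1 + Polynomial.X ^ 2) ^ (D - (s (Sum.inl 0) + s (Sum.inl 1)))) -
      if i = j then Polynomial.C ε * (1 + Polynomial.X ^ 2) ^ D else 0
  have hM : ∀ α i j x, (M α i j).eval x = (1 + x ^ 2) ^ D *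
      (∑ s ∈ U, f ((T i j).coeff s) * (((1 - x ^ 2) / (1 + x ^ 2)) ^ s (Sum.inl 0) *
        (2 * x / (1 + x ^ 2)) ^ s (Sum.inl 1)) *
        bernsteinWeight (β s) (fun i => (α i : ℝ) / N) (1 / N) - if i = j then ε else 0) := by
    intro α i j x
    have hx : 1 + x ^ 2 ≠ 0 := by positivity
    simp only [M, Matrix.of_apply, Polynomial.eval_sub, Polynomial.eval_finsetSum, mul_sub,
      Finset.mul_sum]
    congr 1
    · refine Finset.sum_congr rfl fun s hs => ?_
      have hsplit : (1 + x ^ 2) ^ D = (1 + x ^ 2) ^ s (Sum.inl 0) * (1 + x ^ 2) ^ s (Sum.inl 1) *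
          (1 + x ^ 2) ^ (D - (s (Sum.inl 0) + s (Sum.inl 1))) := by
        rw [← pow_add, ← pow_add]
        congr 1
        have := hUD s hs
        omega
      rw [hsplit, div_pow, div_pow]
      simp only [Polynomial.eval_mul, Polynomial.eval_C, Polynomial.eval_pow, Polynomial.eval_sub,
        Polynomial.eval_one, Polynomial.eval_X, Polynomial.eval_add, Polynomial.eval_ofNat]
      field_simp
    · split_ifs
      · simp [mul_comm]
      · simp
  have hMpos : ∀ α ∈ Finset.piAntidiag (Finset.univ : Finset (Fin n)) N,
      ∀ (x : ℝ) (v : Fin 3 → ℝ), v ≠ 0 → 0 < ∑ i, ∑ j, v i * (M α i j).eval x * v j := by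
    intro α hα x v hv
    obtain ⟨r, hr, u, hu, rfl⟩ := exists_mul_sq_sum_eq_one hv
    have hαsum : ∑ i, α i = N := (Finset.mem_piAntidiag.mp hα).1
    have hmem : (fun i => (α i : ℝ) / N) ∈ stdSimplex ℝ (Fin n) := by
      refine ⟨fun i => by positivity, ?_⟩
      rw [← Finset.sum_div, ← Nat.cast_sum, hαsum, div_self (by positivity)]
    have h := hm ((_, _), u) ⟨rational_circle_point x, hu⟩ _ hmem
    rw [hswap] at h
    have hx : 0 < (1 + x ^ 2) ^ D := by positivity
    have hu' : ε = ∑ i, ∑ j, u i * (if i = j then ε else 0) * u j := by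
      have : ∀ i, ∑ j, u i * (if i = j then ε else 0) * u j = ε * u i ^ 2 := by
        intro i
        simp [mul_ite, ite_mul]
        ring
      simp only [this, ← Finset.mul_sum, hu, mul_one]
    have hscale : ∀ (P : ℝ) (W : Fin 3 → Fin 3 → ℝ),
        r * r * P * (∑ i, ∑ j, u i * W i j * u j - ε) =
          ∑ i, ∑ j, r * u i * (P * (W i j - if i = j then ε else 0)) * (r * u j) := by
      intro P W
      conv_lhs => rw [hu']
      simp only [← Finset.sum_sub_distrib, Finset.mul_sum]
      exact Finset.sum_congr rfl fun i _ => Finset.sum_congr rfl fun j _ => by ring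
    refine lt_of_lt_of_eq (mul_pos (mul_pos (mul_pos hr hr) hx) h) ((hscale _ _).trans ?_)
    simp only [hM]
    rfl
  have hMsymm : ∀ α i j, M α i j = M α j i := by
    intro α i j
    simp only [M, Matrix.of_apply, hsymm i j, eq_comm (a := i) (b := j)]
  have hrep : ∀ α : {α // α ∈ Finset.piAntidiag (Finset.univ : Finset (Fin n)) N},
      ∃ (L : ℕ) (g : Fin L × Bool → Fin 3 → Polynomial ℝ),
        ∀ i j x, (M α i j).eval x = ∑ r, (g r i).eval x * (g r j).eval x := fun α =>
    exists_sum_mul_self (M α) (hMsymm α) (hMpos α α.2)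
  choose L g hg using hrep
  refine ⟨ε, N - d, hε0, ?_⟩
  refine isSOS_of_rows
    (ι := Σ α : {α // α ∈ Finset.piAntidiag (Finset.univ : Finset (Fin n)) N}, Fin (L α) × Bool)
    (fun r i => C (√(Nat.multinomial Finset.univ r.1.1 : ℝ)) *
      (∏ t, X (Sum.inr t) ^ r.1.1 t) *
      (Polynomial.aeval (X (Sum.inl ()))) (g r.1 r.2 i)) ?_
  intro x lam i j
  have hgev : ∀ p : Polynomial ℝ, eval (Sum.elim (fun _ => x) lam)
      (Polynomial.aeval (X (Sum.inl ()) : MvPolynomial (Unit ⊕ Fin n) ℝ) p) = p.eval x := by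
    intro p
    induction p using Polynomial.induction_on' with
    | add p q hp hq => simp [hp, hq]
    | monomial k a => simp [Polynomial.aeval_monomial, MvPolynomial.algebraMap_eq]
  have hsum : ∀ α : {α // α ∈ Finset.piAntidiag (Finset.univ : Finset (Fin n)) N},
      (Nat.multinomial Finset.univ α.1 : ℝ) * (∏ t, (lam t ^ 2) ^ α.1 t) * (M α i j).eval x =
      ∑ r : Fin (L α) × Bool,
        eval (Sum.elim (fun _ => x) lam) (C (√(Nat.multinomial Finset.univ α.1 : ℝ)) *
          (∏ t, X (Sum.inr t) ^ α.1 t) * (Polynomial.aeval (X (Sum.inl ()))) (g α r i)) *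
        eval (Sum.elim (fun _ => x) lam) (C (√(Nat.multinomial Finset.univ α.1 : ℝ)) *
          (∏ t, X (Sum.inr t) ^ α.1 t) * (Polynomial.aeval (X (Sum.inl ()))) (g α r j)) := by
    intro α
    rw [hg, Finset.mul_sum]
    refine Finset.sum_congr rfl fun r _ => ?_
    simp only [map_mul, hgev, eval_C, map_prod, map_pow, eval_X, Sum.elim_inr]
    have h1 : ∏ t, (lam t ^ 2) ^ α.1 t = (∏ t, lam t ^ α.1 t) * ∏ t, lam t ^ α.1 t := by
      rw [← Finset.prod_mul_distrib]
      exact Finset.prod_congr rfl fun t _ => by rw [← mul_pow, sq]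
    have h2 := Real.mul_self_sqrt (Nat.cast_nonneg (α := ℝ) (Nat.multinomial Finset.univ α.1))
    rw [h1]
    conv_lhs => rw [← h2]
    ring
  rw [Fintype.sum_sigma]
  simp only [← hsum]
  rw [Finset.sum_coe_sort (Finset.piAntidiag (Finset.univ : Finset (Fin n)) N) (fun α =>
    (Nat.multinomial Finset.univ α : ℝ) * (∏ t, (lam t ^ 2) ^ α t) * (M α i j).eval x)]
  have hentry : (hom T i j) = homogenize d (T i j) := rfl
  set S := ∑ i, lam i ^ 2 with hS
  have hbern : ∀ γ : Fin n → ℕ, ∑ i, γ i ≤ d → S ^ (N - d) * ((∏ i, (lam i ^ 2) ^ γ i) *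
      S ^ (d - ∑ i, γ i)) =
      ∑ α ∈ Finset.piAntidiag Finset.univ N, (Nat.multinomial Finset.univ α : ℝ) *
        bernsteinWeight γ (fun i => (α i : ℝ) / N) (1 / N) * ∏ i, (lam i ^ 2) ^ α i := by
    intro γ hγ
    rw [← prod_pow_mul_sum_pow γ N hN0 (hγ.trans hNd) (fun i => lam i ^ 2), ← hS,
      show N - ∑ i, γ i = (N - d) + (d - ∑ i, γ i) by omega, pow_add]
    ring
  have hbern0 : S ^ (N - d) * S ^ d = ∑ α ∈ Finset.piAntidiag Finset.univ N,
      (Nat.multinomial Finset.univ α : ℝ) * ∏ i, (lam i ^ 2) ^ α i := by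
    simpa [bernsteinWeight_zero_left] using hbern 0 (by simp)
  simp only [Matrix.smul_apply, Matrix.sub_apply, Matrix.map_apply, hentry, smul_eq_mul,
    Matrix.one_apply]
  rw [eval₂_xlPoint_homogenize f d (T i j) U (hU i j), ← hS]
  simp only [hM]
  calc _ = (1 + x ^ 2) ^ D * (∑ s ∈ U, f ((T i j).coeff s) *
        (((1 - x ^ 2) / (1 + x ^ 2)) ^ s (Sum.inl 0) * (2 * x / (1 + x ^ 2)) ^ s (Sum.inl 1)) *
        (S ^ (N - d) * ((∏ i, (lam i ^ 2) ^ s (Sum.inr i)) * S ^ (d - ∑ t, s (Sum.inr t)))) -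
        (if i = j then ε else 0) * (S ^ (N - d) * S ^ d)) := by
        rw [mul_assoc]
        congr 1
        rw [mul_sub, Finset.mul_sum]
        congr 1
        · exact Finset.sum_congr rfl fun s _ => by ring
        · split_ifs <;> ring
    _ = _ := by
        rw [hbern0, Finset.sum_congr rfl fun s hs => by rw [hbern (β s) (hUd s hs)]]
        simp only [Finset.mul_sum]
        rw [Finset.sum_comm, ← Finset.sum_sub_distrib, Finset.mul_sum]
        refine Finset.sum_congr rfl fun α _ => ?_
        rw [mul_left_comm _ ((1 + x ^ 2) ^ D)]
        congr 1
        rw [mul_sub, Finset.mul_sum]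
        congr 1
        · exact Finset.sum_congr rfl fun s _ => by ring
        · ring

end ILC

namespace ILC

/-! ### The SOS constraint and the bound on the error transfer function -/

open Filter Topology MvPolynomial

section

variable {n k₁ k₂ k₃ k₄ : ℕ} {P : UncertainPlant n} {q : FIRIndex k₃ k₄ → ℝ}

lemma FractionForm.T_symm (R : FractionForm P q k₁ k₂) (i j : Fin 3) : R.T i j = R.T j i := by
  fin_cases i <;> fin_cases j <;> rfl

lemma eval₂_map_rename_some {n : ℕ} {ι : Type} (p : XLPoly n (MvPolynomial ι ℝ)) (l : ι → ℝ)
    (η : ℝ) (y : Fin 2 ⊕ Fin n → ℝ) :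
    eval₂ (eval fun o : Option ι => o.elim η l) y (map (rename some).toRingHom p) =
      eval₂ (eval l) y p := by
  rw [eval₂_map]
  congr 1
  ext i <;> simp

lemma eval₂_map_C {n : ℕ} {ι : Type} (p : XLPoly n ℝ) (l : ι → ℝ) (y : Fin 2 ⊕ Fin n → ℝ) :
    eval₂ (eval l) y (map C p) = eval y p := by
  have : (eval l).comp C = RingHom.id ℝ := by
    ext
    simp
  rw [eval₂_map, this]
  rfl

/-- The quadratic form of `T(l, η, x₁, x₂, lam)`, completed to squares. -/
lemma FractionForm.sum_mul_T_mul (R : FractionForm P q k₁ k₂) (l : FIRIndex k₁ k₂ → ℝ) (η : ℝ)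
    (y : Fin 2 ⊕ Fin n → ℝ) (v : Fin 3 → ℝ) :
    ∑ i, ∑ j, v i * eval₂ (eval fun o => o.elim η l) y (R.T i j) * v j =
      (η * eval y R.ν₃ ^ 2 - eval₂ (eval l) y R.ν₁ ^ 2 - eval₂ (eval l) y R.ν₂ ^ 2) * v 0 ^ 2 +
        (v 1 + eval₂ (eval l) y R.ν₁ * v 0) ^ 2 + (v 2 + eval₂ (eval l) y R.ν₂ * v 0) ^ 2 := by
  simp only [Fin.sum_univ_three, FractionForm.T, Matrix.of_apply, Matrix.cons_val',
    Matrix.cons_val_zero, Matrix.cons_val_one, Matrix.cons_val, eval₂_mul, eval₂_pow,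
    eval₂_map_rename_some, eval₂_map_C, eval₂_C, eval_X, Option.elim_none, eval₂_one, eval₂_zero]
  ring

lemma FractionForm.normSq_errorTransfer (R : FractionForm P q k₁ k₂) (l : FIRIndex k₁ k₂ → ℝ)
    {x₁ x₂ : ℝ} (hx : x₁ ^ 2 + x₂ ^ 2 = 1) {lam : Fin n → ℝ} (hlam : lam ∈ stdSimplex ℝ (Fin n)) :
    Complex.normSq (errorTransfer P q l lam (x₁ + x₂ * Complex.I)) =
      (eval₂ (eval l) (xlPoint x₁ x₂ lam) R.ν₁ ^ 2 + eval₂ (eval l) (xlPoint x₁ x₂ lam) R.ν₂ ^ 2) /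
        eval (xlPoint x₁ x₂ lam) R.ν₃ ^ 2 := by
  rw [R.eq l x₁ x₂ hx lam hlam, map_div₀, Complex.normSq_add_mul_I, Complex.normSq_ofReal, ← sq]

lemma norm_add_mul_I_eq_one {x₁ x₂ : ℝ} (hx : x₁ ^ 2 + x₂ ^ 2 = 1) :
    ‖(x₁ + x₂ * Complex.I : ℂ)‖ = 1 := by
  rw [Complex.norm_add_mul_I, hx, Real.sqrt_one]

lemma re_sq_add_im_sq_of_norm_eq_one {z : ℂ} (hz : ‖z‖ = 1) : z.re ^ 2 + z.im ^ 2 = 1 := by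
  have := Complex.normSq_eq_norm_sq z
  rw [hz, Complex.normSq_apply] at this
  nlinarith

/-- A strict bound on the error transfer function makes `T` positive definite, so that it has an
SOS certificate. -/
theorem FractionForm.exists_SOSConstraint (R : FractionForm P q k₁ k₂) (l : FIRIndex k₁ k₂ → ℝ)
    (η : ℝ) (h : ∀ z : ℂ, ‖z‖ = 1 → ∀ lam ∈ stdSimplex ℝ (Fin n),
      Complex.normSq (errorTransfer P q l lam z) < η) :
    ∃ (ε : ℝ) (k : ℕ), 0 < ε ∧ R.SOSConstraint l η ε k := by
  refine exists_isSOS_of_posDef (eval fun o : Option (FIRIndex k₁ k₂) => o.elim η l) R.T R.T_symm ?_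
  intro x₁ x₂ hx lam hlam v hv
  rw [R.sum_mul_T_mul]
  have h1 := h _ (norm_add_mul_I_eq_one hx) lam hlam
  have h3 := R.ν₃_ne_zero x₁ x₂ hx lam hlam
  rw [R.normSq_errorTransfer l hx hlam, div_lt_iff₀ (by positivity)] at h1
  set a := eval₂ (eval l) (xlPoint x₁ x₂ lam) R.ν₁
  set b := eval₂ (eval l) (xlPoint x₁ x₂ lam) R.ν₂
  have hpos : 0 < η * eval (xlPoint x₁ x₂ lam) R.ν₃ ^ 2 - a ^ 2 - b ^ 2 := by linarith
  by_cases h0 : v 0 = 0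
  · simp only [h0, mul_zero, add_zero]
    by_cases h1 : v 1 = 0
    · have h2 : v 2 ≠ 0 := fun h2 => hv (funext fun i => by fin_cases i <;> assumption)
      positivity
    · positivity
  · positivity

lemma mul_sum_sq_le_of_SOSConstraint (R : FractionForm P q k₁ k₂) (l : FIRIndex k₁ k₂ → ℝ)
    {η ε : ℝ} {k : ℕ} (h : R.SOSConstraint l η ε k) (x : ℝ) {lam : Fin n → ℝ}
    (hlam : lam ∈ stdSimplex ℝ (Fin n)) (v : Fin 3 → ℝ) :
    ε * ∑ i, v i ^ 2 ≤ ∑ i, ∑ j, v i * eval₂ (eval fun o => o.elim η l)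
      (xlPoint ((1 - x ^ 2) / (1 + x ^ 2)) (2 * x / (1 + x ^ 2)) lam) (R.T i j) * v j := by
  obtain ⟨N, G, hG⟩ := h
  have h1 := hG x fun i => √(lam i)
  simp only [Real.sq_sqrt (hlam.1 _), hlam.2, one_pow, mul_one] at h1
  have hpos : 0 ≤ v ⬝ᵥ Matrix.mulVec (∑ i, ((G i).map (eval (Sum.elim (fun _ => x)
      fun i => √(lam i)))).transpose * (G i).map (eval (Sum.elim (fun _ => x)
        fun i => √(lam i)))) v := by
    rw [Matrix.sum_mulVec, dotProduct_sum]
    refine Finset.sum_nonneg fun r _ => ?_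
    rw [← Matrix.mulVec_mulVec, Matrix.dotProduct_mulVec, Matrix.vecMul_transpose]
    exact Finset.sum_nonneg fun i _ => mul_self_nonneg _
  rw [← h1, Matrix.smul_mulVec, dotProduct_smul, smul_eq_mul] at hpos
  have h3 : (0 : ℝ) < (1 + x ^ 2) ^ degX R.T := by positivity
  have h4 := nonneg_of_mul_nonneg_right hpos h3
  rw [Matrix.sub_mulVec, dotProduct_sub, Matrix.smul_mulVec, Matrix.one_mulVec, dotProduct_smul,
    smul_eq_mul, sub_nonneg] at h4
  refine le_trans (le_of_eq ?_) (h4.trans (le_of_eq ?_))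
  · simp only [dotProduct, sq]
  · simp only [dotProduct, Matrix.mulVec, Finset.mul_sum]
    refine Finset.sum_congr rfl fun i _ => Finset.sum_congr rfl fun j _ => ?_
    simp only [FractionForm.THat, hom, Matrix.map_apply]
    rw [eval₂_homogenize_of_mem_stdSimplex _ _ _ _ _ hlam]
    ring

/-- An SOS certificate bounds the error transfer function strictly. The point `z = -1`, which the
rational parametrization of the circle leaves out, is a limit of the others. -/
theorem FractionForm.lt_of_SOSConstraint (R : FractionForm P q k₁ k₂) (l : FIRIndex k₁ k₂ → ℝ)
    {η ε : ℝ} {k : ℕ} (hε : 0 < ε) (h : R.SOSConstraint l η ε k) (z : ℂ) (hz : ‖z‖ = 1)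
    (lam : Fin n → ℝ) (hlam : lam ∈ stdSimplex ℝ (Fin n)) :
    Complex.normSq (errorTransfer P q l lam z) < η := by
  have hx := re_sq_add_im_sq_of_norm_eq_one hz
  rw [← Complex.re_add_im z, R.normSq_errorTransfer l hx hlam]
  set x₁ := z.re
  set x₂ := z.im
  have key : ∀ v : Fin 3 → ℝ, ε * ∑ i, v i ^ 2 ≤ ∑ i, ∑ j, v i *
      eval₂ (eval fun o => o.elim η l) (xlPoint x₁ x₂ lam) (R.T i j) * v j := by
    intro v
    by_cases h1 : 1 + x₁ = 0
    · have e1 : x₁ = -1 := by linarith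
      have e2 : x₂ = 0 := by rw [e1] at hx; nlinarith [sq_nonneg x₂]
      -- with `x = 1 / s`, the point `z = -1` is `s = 0`
      let g : ℝ → ℝ := fun s => ∑ i, ∑ j, v i * eval₂ (eval fun o => o.elim η l)
        (xlPoint ((s ^ 2 - 1) / (s ^ 2 + 1)) (2 * s / (s ^ 2 + 1)) lam) (R.T i j) * v j
      have hpos : ∀ s : ℝ, s ^ 2 + 1 ≠ 0 := fun s => by positivity
      have hg : Continuous g := by
        simp only [g, eval₂_xlPoint _ _ _ subset_rfl]
        fun_prop (disch := exact hpos _)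
      have hlim : Tendsto g (𝓝[≠] 0) (𝓝 (g 0)) := hg.continuousAt.continuousWithinAt
      have hle : ε * ∑ i, v i ^ 2 ≤ g 0 := by
        refine ge_of_tendsto hlim (eventually_mem_nhdsWithin.mono fun s hs => ?_)
        have hs' : s ≠ 0 := hs
        have := mul_sum_sq_le_of_SOSConstraint R l h (1 / s) hlam v
        have a1 : (1 - (1 / s) ^ 2) / (1 + (1 / s) ^ 2) = (s ^ 2 - 1) / (s ^ 2 + 1) := by
          have := hpos s
          field_simp
        have a2 : 2 * (1 / s) / (1 + (1 / s) ^ 2) = 2 * s / (s ^ 2 + 1) := by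
          have := hpos s
          field_simp
        rwa [a1, a2] at this
      simpa [g, e1, e2] using hle
    · have := mul_sum_sq_le_of_SOSConstraint R l h (x₂ / (1 + x₁)) hlam v
      have hs : 1 + (x₂ / (1 + x₁)) ^ 2 = 2 / (1 + x₁) := by
        field_simp
        linear_combination hx
      have a1 : (1 - (x₂ / (1 + x₁)) ^ 2) / (1 + (x₂ / (1 + x₁)) ^ 2) = x₁ := by
        rw [hs]
        field_simp
        linear_combination -hx
      have a2 : 2 * (x₂ / (1 + x₁)) / (1 + (x₂ / (1 + x₁)) ^ 2) = x₂ := by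
        rw [hs]
        field_simp
      rwa [a1, a2] at this
  have h3 := R.ν₃_ne_zero x₁ x₂ hx lam hlam
  rw [div_lt_iff₀ (by positivity)]
  have h4 := key ![1, -eval₂ (eval l) (xlPoint x₁ x₂ lam) R.ν₁,
    -eval₂ (eval l) (xlPoint x₁ x₂ lam) R.ν₂]
  rw [R.sum_mul_T_mul] at h4
  simp only [Fin.sum_univ_three, Matrix.cons_val_zero, Matrix.cons_val_one, Matrix.cons_val] at h4
  have h5 : 0 < ε * (1 ^ 2 + (-eval₂ (eval l) (xlPoint x₁ x₂ lam) R.ν₁) ^ 2 +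
    (-eval₂ (eval l) (xlPoint x₁ x₂ lam) R.ν₂) ^ 2) := by positivity
  linarith

end

end ILC

namespace ILC

/-! ### The min–max problem as best approximation in a space of continuous functions -/

section

open Filter Topology

/-- The product of the unit circle and the simplex. -/
abbrev CircleSimplex (n : ℕ) : Type :=
  ↥(Metric.sphere (0 : ℂ) 1 ×ˢ stdSimplex ℝ (Fin n))

instance (n : ℕ) : CompactSpace (CircleSimplex n) :=
  isCompact_iff_compactSpace.mp ((isCompact_sphere 0 1).prod (isCompact_stdSimplex ℝ (Fin n)))

/-- The distance from a vector to the range of a linear map on a finite-dimensional space is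
attained. -/
lemma exists_norm_sub_le {V E : Type*} [AddCommGroup V] [Module ℝ V] [FiniteDimensional ℝ V]
    [NormedAddCommGroup E] [NormedSpace ℝ E] (Φ : V →ₗ[ℝ] E) (a : E) :
    ∃ l₀, ∀ l, ‖a - Φ l₀‖ ≤ ‖a - Φ l‖ := by
  have : ProperSpace (LinearMap.range Φ) := FiniteDimensional.proper ℝ _
  have hcont : Continuous fun w : LinearMap.range Φ => ‖a - (w : E)‖ := by fun_prop
  have hlim : Tendsto (fun w : LinearMap.range Φ => ‖a - (w : E)‖) (cocompact _) atTop := by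
    refine tendsto_atTop_mono (f := fun w : LinearMap.range Φ => ‖w‖ - ‖a‖) (fun w => ?_) ?_
    · rw [norm_sub_rev]
      exact norm_sub_norm_le (w : E) a
    · exact tendsto_atTop_add_const_right _ _ tendsto_norm_cocompact_atTop
  obtain ⟨⟨_, l₀, rfl⟩, hw⟩ := hcont.exists_forall_le hlim
  exact ⟨l₀, fun l => hw ⟨Φ l, l, rfl⟩⟩

variable {n k₁ k₂ k₃ k₄ : ℕ}

lemma RatFun.continuous_value (r : RatFun n) :
    Continuous fun p : CircleSimplex n => r.value p.1.2 := by
  unfold RatFun.value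
  refine Continuous.div ?_ ?_ fun p => r.den_ne_zero _ p.2.2
  · exact (MvPolynomial.continuous_eval r.num).comp (by fun_prop)
  · exact (MvPolynomial.continuous_eval r.den).comp (by fun_prop)

lemma UncertainPlant.continuous_transfer (P : UncertainPlant n) :
    Continuous fun p : CircleSimplex n => P.transfer p.1.1 p.1.2 := by
  unfold UncertainPlant.transfer
  have h := fun r : RatFun n => r.continuous_value
  refine Continuous.div ?_ ?_ fun p => P.stable _ p.2.2 _ ?_
  · refine continuous_finsetSum _ fun i _ => ?_
    exact (Complex.continuous_ofReal.comp (h _)).mul (by fun_prop)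
  · refine continuous_finsetSum _ fun i _ => ?_
    exact (Complex.continuous_ofReal.comp (h _)).mul (by fun_prop)
  · exact (mem_sphere_zero_iff_norm.mp p.2.1).ge

lemma ne_zero_of_circleSimplex (p : CircleSimplex n) : p.1.1 ≠ 0 := by
  have := mem_sphere_zero_iff_norm.mp p.2.1
  rintro h
  simp [h] at this

lemma continuous_fir (c : FIRIndex k₁ k₂ → ℝ) :
    Continuous fun p : CircleSimplex n => fir c p.1.1 := by
  unfold fir
  refine continuous_finsetSum _ fun i _ => continuous_const.mul ?_
  exact Continuous.zpow₀ (by fun_prop) _ fun p => Or.inl (ne_zero_of_circleSimplex p)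

/-- The part of the error transfer function that does not depend on `l`. -/
def filterMap (n : ℕ) (q : FIRIndex k₃ k₄ → ℝ) : C(CircleSimplex n, ℂ) :=
  ⟨fun p => fir q p.1.1, continuous_fir q⟩

/-- The part of the error transfer function that is linear in `l`, with its sign changed. -/
def learningMap (P : UncertainPlant n) (q : FIRIndex k₃ k₄ → ℝ) (k₁ k₂ : ℕ) :
    (FIRIndex k₁ k₂ → ℝ) →ₗ[ℝ] C(CircleSimplex n, ℂ) where
  toFun l := ⟨fun p => fir q p.1.1 * (p.1.1 * fir l p.1.1 * P.transfer p.1.1 p.1.2), by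
    have h1 := continuous_fir (n := n) q
    have h2 := continuous_fir (n := n) l
    have h3 := P.continuous_transfer
    fun_prop⟩
  map_add' l l' := by
    ext p
    simp [fir, add_mul, mul_add, Finset.sum_add_distrib]
  map_smul' c l := by
    ext p
    simp only [fir, Pi.smul_apply, smul_eq_mul, Complex.ofReal_mul, mul_assoc, ← Finset.mul_sum,
      RingHom.id_apply, ContinuousMap.coe_mk, ContinuousMap.coe_smul, Complex.real_smul]
    ring

lemma filterMap_sub_learningMap_apply (P : UncertainPlant n) (q : FIRIndex k₃ k₄ → ℝ)
    (l : FIRIndex k₁ k₂ → ℝ) (p : CircleSimplex n) :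
    (filterMap n q - learningMap P q k₁ k₂ l) p = errorTransfer P q l p.1.2 p.1.1 := by
  simp only [filterMap, learningMap, errorTransfer, ContinuousMap.coe_sub, Pi.sub_apply,
    ContinuousMap.coe_mk, LinearMap.coe_mk, AddHom.coe_mk]
  ring

/-- The objective of the min–max problem as a real number: the distance from `Q` to
`Q z L P` in the supremum norm over the circle and the simplex. -/
def rate (P : UncertainPlant n) (q : FIRIndex k₃ k₄ → ℝ) (l : FIRIndex k₁ k₂ → ℝ) : ℝ :=
  ‖filterMap n q - learningMap P q k₁ k₂ l‖

lemma rate_nonneg (P : UncertainPlant n) (q : FIRIndex k₃ k₄ → ℝ) (l : FIRIndex k₁ k₂ → ℝ) :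
    0 ≤ rate P q l := norm_nonneg _

lemma norm_errorTransfer_le_rate (P : UncertainPlant n) (q : FIRIndex k₃ k₄ → ℝ)
    (l : FIRIndex k₁ k₂ → ℝ) {z : ℂ} (hz : ‖z‖ = 1) {lam : Fin n → ℝ}
    (hlam : lam ∈ stdSimplex ℝ (Fin n)) : ‖errorTransfer P q l lam z‖ ≤ rate P q l := by
  have := (filterMap n q - learningMap P q k₁ k₂ l).norm_coe_le_norm
    ⟨(z, lam), mem_sphere_zero_iff_norm.mpr hz, hlam⟩
  rwa [filterMap_sub_learningMap_apply] at this

lemma rate_le (P : UncertainPlant n) (q : FIRIndex k₃ k₄ → ℝ) (l : FIRIndex k₁ k₂ → ℝ) {c : ℝ}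
    (hc : 0 ≤ c) (h : ∀ z : ℂ, ‖z‖ = 1 → ∀ lam ∈ stdSimplex ℝ (Fin n),
      ‖errorTransfer P q l lam z‖ ≤ c) : rate P q l ≤ c := by
  refine (ContinuousMap.norm_le _ hc).mpr fun p => ?_
  rw [filterMap_sub_learningMap_apply]
  exact h _ (mem_sphere_zero_iff_norm.mp p.2.1) _ p.2.2

lemma robustRate_eq (P : UncertainPlant n) (q : FIRIndex k₃ k₄ → ℝ) (l : FIRIndex k₁ k₂ → ℝ) :
    robustRate P q l = ENNReal.ofReal (rate P q l) := by
  refine le_antisymm ?_ ?_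
  · refine iSup₂_le fun lam hlam => iSup₂_le fun z hz => ?_
    rw [← ofReal_norm]
    exact ENNReal.ofReal_le_ofReal
      (norm_errorTransfer_le_rate P q l (mem_sphere_zero_iff_norm.mp hz) hlam)
  · by_cases htop : robustRate P q l = ∞
    · simp [htop]
    rw [ENNReal.ofReal_le_iff_le_toReal htop]
    refine rate_le P q l ENNReal.toReal_nonneg fun z hz lam hlam => ?_
    rw [← toReal_enorm]
    refine ENNReal.toReal_mono htop ?_
    have h1 : ‖errorTransfer P q l lam z‖ₑ ≤ hinfNorm (errorTransfer P q l lam) :=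
      le_iSup₂_of_le z (mem_sphere_zero_iff_norm.mpr hz) le_rfl
    exact h1.trans (le_iSup₂_of_le (f := fun lam (_ : lam ∈ stdSimplex ℝ (Fin n)) =>
      hinfNorm (errorTransfer P q l lam)) lam hlam le_rfl)

lemma exists_rate_le (P : UncertainPlant n) (q : FIRIndex k₃ k₄ → ℝ) (k₁ k₂ : ℕ) :
    ∃ l₀ : FIRIndex k₁ k₂ → ℝ, ∀ l : FIRIndex k₁ k₂ → ℝ, rate P q l₀ ≤ rate P q l :=
  exists_norm_sub_le (learningMap P q k₁ k₂) (filterMap n q)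

end

end ILC

namespace ILC

/-! ### Existence of a fraction form -/

open MvPolynomial

/-- A complex function of `(x₁, x₂, lam)` whose real and imaginary parts are real polynomials. -/
def IsPolyFun {n : ℕ} (F : ℝ → ℝ → (Fin n → ℝ) → ℂ) : Prop :=
  ∃ p₁ p₂ : XLPoly n ℝ, ∀ x₁ x₂ lam,
    F x₁ x₂ lam = (eval (xlPoint x₁ x₂ lam) p₁ : ℝ) + (eval (xlPoint x₁ x₂ lam) p₂ : ℝ) * Complex.I

namespace IsPolyFun

variable {n : ℕ} {F G : ℝ → ℝ → (Fin n → ℝ) → ℂ}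

lemma const (c : ℂ) : IsPolyFun fun (_ _ : ℝ) (_ : Fin n → ℝ) => c :=
  ⟨C c.re, C c.im, fun _ _ _ => by simp⟩

lemma point : IsPolyFun fun (x₁ x₂ : ℝ) (_ : Fin n → ℝ) => (x₁ + x₂ * Complex.I : ℂ) :=
  ⟨X (Sum.inl 0), X (Sum.inl 1), fun _ _ _ => by simp [xlPoint]⟩

lemma ofReal_eval (p : MvPolynomial (Fin n) ℝ) :
    IsPolyFun fun (_ _ : ℝ) (lam : Fin n → ℝ) => ((eval lam p : ℝ) : ℂ) :=
  ⟨rename Sum.inr p, 0, fun x₁ x₂ lam => by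
    have : xlPoint x₁ x₂ lam ∘ Sum.inr = lam := by ext; simp [xlPoint]
    simp [eval_rename, this]⟩

lemma add (hF : IsPolyFun F) (hG : IsPolyFun G) :
    IsPolyFun fun x₁ x₂ lam => F x₁ x₂ lam + G x₁ x₂ lam := by
  obtain ⟨p₁, p₂, hp⟩ := hF
  obtain ⟨r₁, r₂, hr⟩ := hG
  refine ⟨p₁ + r₁, p₂ + r₂, fun x₁ x₂ lam => ?_⟩
  simp only [hp, hr]
  push_cast [map_add]
  ring

lemma mul (hF : IsPolyFun F) (hG : IsPolyFun G) :
    IsPolyFun fun x₁ x₂ lam => F x₁ x₂ lam * G x₁ x₂ lam := by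
  obtain ⟨p₁, p₂, hp⟩ := hF
  obtain ⟨r₁, r₂, hr⟩ := hG
  refine ⟨p₁ * r₁ - p₂ * r₂, p₁ * r₂ + p₂ * r₁, fun x₁ x₂ lam => ?_⟩
  simp only [hp, hr]
  push_cast [map_add, map_sub, map_mul]
  linear_combination ((eval (xlPoint x₁ x₂ lam) p₂ : ℝ) : ℂ) *
    ((eval (xlPoint x₁ x₂ lam) r₂ : ℝ) : ℂ) * Complex.I_sq

lemma conj (hF : IsPolyFun F) : IsPolyFun fun x₁ x₂ lam => starRingEnd ℂ (F x₁ x₂ lam) := by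
  obtain ⟨p₁, p₂, hp⟩ := hF
  exact ⟨p₁, -p₂, fun x₁ x₂ lam => by simp [hp]⟩

lemma pow (hF : IsPolyFun F) (k : ℕ) : IsPolyFun fun x₁ x₂ lam => F x₁ x₂ lam ^ k := by
  induction k with
  | zero => simpa using const 1
  | succ k ih => simpa only [pow_succ] using ih.mul hF

lemma sum {ι : Type*} (s : Finset ι) {F : ι → ℝ → ℝ → (Fin n → ℝ) → ℂ}
    (hF : ∀ i, IsPolyFun (F i)) : IsPolyFun fun x₁ x₂ lam => ∑ i ∈ s, F i x₁ x₂ lam := by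
  classical
  induction s using Finset.induction_on with
  | empty => simpa using const 0
  | insert a s ha ih => simpa only [Finset.sum_insert ha] using (hF a).add ih

end IsPolyFun

/-- Integer powers of `z`, written without inverses: on the unit circle `z⁻¹` is the conjugate
of `z`. -/
def circlePow (z : ℂ) (m : ℤ) : ℂ := z ^ m.toNat * (starRingEnd ℂ z) ^ (-m).toNat

lemma circlePow_eq {z : ℂ} (hz : ‖z‖ = 1) (m : ℤ) : circlePow z m = z ^ m := by
  have hinv : starRingEnd ℂ z = z⁻¹ := (Complex.inv_eq_conj hz).symm
  have h0 : z ≠ 0 := by rintro rfl; simp at hz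
  rw [circlePow, hinv, inv_pow, ← zpow_natCast, ← zpow_natCast, ← zpow_neg, ← zpow_add₀ h0]
  congr 1
  omega

lemma isPolyFun_circlePow (n : ℕ) (m : ℤ) :
    IsPolyFun fun (x₁ x₂ : ℝ) (_ : Fin n → ℝ) => circlePow (x₁ + x₂ * Complex.I) m :=
  (IsPolyFun.point.pow _).mul (IsPolyFun.point.conj.pow _)

lemma fir_eq_sum_circlePow {k k' : ℕ} (c : FIRIndex k k' → ℝ) {z : ℂ} (hz : ‖z‖ = 1) :
    fir c z = ∑ i, (c i : ℂ) * circlePow z (-(i : ℤ)) := by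
  simp only [fir, circlePow_eq hz]

/-- The polynomial `∑ r_i(lam) z ^ i` becomes polynomial in `lam` after multiplication by the
product of the denominators of its coefficients. -/
lemma exists_isPolyFun_clear_denom {n k : ℕ} (r : Fin (k + 1) → RatFun n) :
    ∃ (N : ℝ → ℝ → (Fin n → ℝ) → ℂ) (D : MvPolynomial (Fin n) ℝ), IsPolyFun N ∧
      (∀ lam ∈ stdSimplex ℝ (Fin n), eval lam D ≠ 0) ∧
      ∀ (x₁ x₂ : ℝ), ∀ lam ∈ stdSimplex ℝ (Fin n),
        N x₁ x₂ lam = ((eval lam D : ℝ) : ℂ) *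
          ∑ i, ((r i).value lam : ℂ) * (x₁ + x₂ * Complex.I) ^ (i : ℕ) := by
  classical
  refine ⟨fun x₁ x₂ lam => ∑ i, ((eval lam ((r i).num * ∏ j ∈ Finset.univ.erase i, (r j).den) : ℝ) :
    ℂ) * (x₁ + x₂ * Complex.I) ^ (i : ℕ), ∏ i, (r i).den, ?_, fun lam hlam => ?_,
    fun x₁ x₂ lam hlam => ?_⟩
  · exact IsPolyFun.sum _ fun i => (IsPolyFun.ofReal_eval _).mul (IsPolyFun.point.pow _)
  · rw [map_prod]
    exact Finset.prod_ne_zero_iff.mpr fun i _ => (r i).den_ne_zero lam hlam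
  · rw [Finset.mul_sum]
    refine Finset.sum_congr rfl fun i _ => ?_
    have h := (r i).den_ne_zero lam hlam
    rw [← mul_assoc, ← Complex.ofReal_mul, ← Finset.mul_prod_erase _ _ (Finset.mem_univ i)]
    congr 2
    rw [map_mul, map_mul, RatFun.value]
    field_simp

section

variable {ι : Type} [Fintype ι] {n : ℕ}

/-- The polynomial `a - ∑ l_i b_i`, with indeterminates `l_i` in the coefficients. -/
def affinePoly (a : XLPoly n ℝ) (b : ι → XLPoly n ℝ) : XLPoly n (MvPolynomial ι ℝ) :=
  map C a - ∑ i, C (X i) * map C (b i)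

lemma totalDegree_coeff_affinePoly (a : XLPoly n ℝ) (b : ι → XLPoly n ℝ)
    (s : Fin 2 ⊕ Fin n →₀ ℕ) : ((affinePoly a b).coeff s).totalDegree ≤ 1 := by
  rw [affinePoly, coeff_sub, coeff_sum, coeff_map]
  refine (totalDegree_sub _ _).trans (max_le (by simp) ?_)
  refine totalDegree_finsetSum_le fun i _ => ?_
  rw [coeff_C_mul, coeff_map]
  exact (totalDegree_mul _ _).trans (by simp)

lemma eval₂_affinePoly (a : XLPoly n ℝ) (b : ι → XLPoly n ℝ) (l : ι → ℝ)
    (y : Fin 2 ⊕ Fin n → ℝ) :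
    eval₂ (eval l) y (affinePoly a b) = eval y a - ∑ i, l i * eval y (b i) := by
  rw [affinePoly, ← coe_eval₂Hom, map_sub, map_sum]
  simp only [map_mul, coe_eval₂Hom, eval₂_map_C, eval₂_C, eval_X]

end

/-- A fraction form: clear the denominators of the coefficients of the plant, replace `z⁻¹` by the
conjugate of `z`, and make the denominator real by multiplying with its conjugate. -/
theorem nonempty_fractionForm {n k₃ k₄ : ℕ} (P : UncertainPlant n) (k₁ k₂ : ℕ)
    (q : FIRIndex k₃ k₄ → ℝ) : Nonempty (FractionForm P q k₁ k₂) := by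
  obtain ⟨Nb, Db, hNb, hDb, hb⟩ := exists_isPolyFun_clear_denom P.b
  obtain ⟨Na, Da, hNa, hDa, ha⟩ := exists_isPolyFun_clear_denom P.a
  let Q : ℝ → ℝ → (Fin n → ℝ) → ℂ := fun x₁ x₂ _ =>
    ∑ i, (q i : ℂ) * circlePow (x₁ + x₂ * Complex.I) (-(i : ℤ))
  have hQ : IsPolyFun Q := IsPolyFun.sum _ fun i =>
    (IsPolyFun.const _).mul (isPolyFun_circlePow n _)
  -- `P = (Nb Da) / (Na Db)`; multiply numerator and denominator by the conjugate of `Na Db`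
  have hden : IsPolyFun fun x₁ x₂ lam => starRingEnd ℂ (Na x₁ x₂ lam) * ((eval lam Db : ℝ) : ℂ) :=
    hNa.conj.mul (IsPolyFun.ofReal_eval Db)
  have hA := hQ.mul ((hNa.mul (IsPolyFun.ofReal_eval Db)).mul hden)
  have hB := fun i : FIRIndex k₁ k₂ => (hQ.mul ((IsPolyFun.point.mul
    (isPolyFun_circlePow n (-(i : ℤ)))).mul (hNb.mul (IsPolyFun.ofReal_eval Da)))).mul hden
  obtain ⟨A₁, A₂, hA⟩ := hA
  choose B₁ B₂ hB using hB
  beta_reduce at hA hB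
  obtain ⟨p₁, p₂, hp⟩ := hNa
  have hν : ∀ x₁ x₂ lam, ((eval (xlPoint x₁ x₂ lam)
      ((p₁ ^ 2 + p₂ ^ 2) * rename Sum.inr Db ^ 2 : XLPoly n ℝ) : ℝ) : ℂ) =
      (Na x₁ x₂ lam * ((eval lam Db : ℝ) : ℂ)) *
        (starRingEnd ℂ (Na x₁ x₂ lam) * ((eval lam Db : ℝ) : ℂ)) := by
    intro x₁ x₂ lam
    have : xlPoint x₁ x₂ lam ∘ Sum.inr = lam := by ext; simp [xlPoint]
    rw [hp]
    simp only [map_mul, map_add, map_pow, eval_rename, this, Complex.conj_ofReal, Complex.conj_I]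
    push_cast
    linear_combination ((eval (xlPoint x₁ x₂ lam) p₂ : ℝ) : ℂ) ^ 2 *
      ((eval lam Db : ℝ) : ℂ) ^ 2 * Complex.I_sq
  have hne : ∀ x₁ x₂ : ℝ, x₁ ^ 2 + x₂ ^ 2 = 1 → ∀ lam ∈ stdSimplex ℝ (Fin n),
      Na x₁ x₂ lam ≠ 0 ∧ ((eval lam Db : ℝ) : ℂ) ≠ 0 ∧ ((eval lam Da : ℝ) : ℂ) ≠ 0 := by
    intro x₁ x₂ hx lam hlam
    have h1 := Complex.ofReal_ne_zero.mpr (hDa lam hlam)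
    refine ⟨?_, Complex.ofReal_ne_zero.mpr (hDb lam hlam), h1⟩
    rw [ha x₁ x₂ lam hlam]
    exact mul_ne_zero h1 (P.stable lam hlam _ (norm_add_mul_I_eq_one hx).ge)
  refine ⟨⟨affinePoly A₁ B₁, affinePoly A₂ B₂, (p₁ ^ 2 + p₂ ^ 2) * rename Sum.inr Db ^ 2,
    totalDegree_coeff_affinePoly _ _, totalDegree_coeff_affinePoly _ _, ?_, ?_⟩⟩
  · intro x₁ x₂ hx lam hlam h0
    have h1 := hν x₁ x₂ lam
    obtain ⟨h2, h3, -⟩ := hne x₁ x₂ hx lam hlam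
    rw [h0, Complex.ofReal_zero] at h1
    exact mul_ne_zero (mul_ne_zero h2 h3) (mul_ne_zero ((map_ne_zero _).mpr h2) h3) h1.symm
  · intro l x₁ x₂ hx lam hlam
    obtain ⟨h2, h3, h4⟩ := hne x₁ x₂ hx lam hlam
    have h5 : starRingEnd ℂ (Na x₁ x₂ lam) ≠ 0 := (map_ne_zero _).mpr h2
    have hz := norm_add_mul_I_eq_one hx
    have htr : P.transfer (x₁ + x₂ * Complex.I) lam =
        (Nb x₁ x₂ lam * ((eval lam Da : ℝ) : ℂ)) / (Na x₁ x₂ lam * ((eval lam Db : ℝ) : ℂ)) := by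
      have h6 : ∑ i, ((P.a i).value lam : ℂ) * (x₁ + x₂ * Complex.I) ^ (i : ℕ) ≠ 0 :=
        P.stable lam hlam _ hz.ge
      rw [UncertainPlant.transfer, hb x₁ x₂ lam hlam, ha x₁ x₂ lam hlam]
      field_simp
    have hnum : ((eval₂ (eval l) (xlPoint x₁ x₂ lam) (affinePoly A₁ B₁) : ℝ) : ℂ) +
        (eval₂ (eval l) (xlPoint x₁ x₂ lam) (affinePoly A₂ B₂) : ℝ) * Complex.I =
        Q x₁ x₂ lam * ((Na x₁ x₂ lam * ((eval lam Db : ℝ) : ℂ)) *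
          (starRingEnd ℂ (Na x₁ x₂ lam) * ((eval lam Db : ℝ) : ℂ))) -
        ∑ i, (l i : ℂ) * (Q x₁ x₂ lam * ((x₁ + x₂ * Complex.I) *
          circlePow (x₁ + x₂ * Complex.I) (-(i : ℤ)) * (Nb x₁ x₂ lam * ((eval lam Da : ℝ) : ℂ))) *
          (starRingEnd ℂ (Na x₁ x₂ lam) * ((eval lam Db : ℝ) : ℂ))) := by
      rw [hA, Finset.sum_congr rfl fun i _ => by rw [hB i x₁ x₂ lam], eval₂_affinePoly,
        eval₂_affinePoly]
      push_cast
      simp only [mul_add, Finset.sum_add_distrib, sub_mul, Finset.sum_mul, ← mul_assoc]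
      ring
    rw [hnum, hν, errorTransfer, fir_eq_sum_circlePow q hz, fir_eq_sum_circlePow l hz, htr,
      eq_div_iff (mul_ne_zero (mul_ne_zero h2 h3) (mul_ne_zero h5 h3))]
    change Q x₁ x₂ lam * _ * _ = _
    rw [mul_assoc, sub_mul, one_mul, mul_sub]
    congr 1
    simp only [Finset.mul_sum, Finset.sum_mul]
    refine Finset.sum_congr rfl fun i _ => ?_
    field_simp

end ILC

namespace ILC

/-! ### The three optimization problems -/

section

variable {n k₁ k₂ k₃ k₄ : ℕ} {P : UncertainPlant n} {q : FIRIndex k₃ k₄ → ℝ}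

lemma normSq_lt_of_sq_rate_lt {l : FIRIndex k₁ k₂ → ℝ} {h : ℝ} (hl : rate P q l ^ 2 < h) {z : ℂ}
    (hz : ‖z‖ = 1) {lam : Fin n → ℝ} (hlam : lam ∈ stdSimplex ℝ (Fin n)) :
    Complex.normSq (errorTransfer P q l lam z) < h := by
  rw [Complex.normSq_eq_norm_sq]
  exact (pow_le_pow_left₀ (norm_nonneg _) (norm_errorTransfer_le_rate P q l hz hlam) 2).trans_lt hl

/-- A bound `h` of `|F|²` bounds the square of the rate. For `n = 0` the simplex is empty, and
nothing would force `0 ≤ h`. -/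
lemma sq_rate_le_of_normSq_lt (hn : 0 < n) {l : FIRIndex k₁ k₂ → ℝ} {h : ℝ}
    (hl : ∀ z : ℂ, ‖z‖ = 1 → ∀ lam ∈ stdSimplex ℝ (Fin n),
      Complex.normSq (errorTransfer P q l lam z) < h) : rate P q l ^ 2 ≤ h := by
  have h0 : 0 ≤ h := (Complex.normSq_nonneg _).trans
    (hl 1 (by simp) _ (single_mem_stdSimplex ℝ (⟨0, hn⟩ : Fin n))).le
  refine (Real.le_sqrt (rate_nonneg P q l) h0).mp (rate_le P q l (Real.sqrt_nonneg h) ?_)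
  intro z hz lam hlam
  refine Real.le_sqrt_of_sq_le ?_
  rw [← Complex.normSq_eq_norm_sq]
  exact (hl z hz lam hlam).le

lemma isGLB_of_forall_lt {s : Set ℝ} {a : ℝ} (h₁ : ∀ x ∈ s, a ≤ x) (h₂ : ∀ x, a < x → x ∈ s) :
    IsGLB s a :=
  ⟨h₁, fun _ hb => le_of_forall_gt_imp_ge_of_dense fun x hx => hb (h₂ x hx)⟩

lemma isGLB_SOSConstraint (hn : 0 < n) (R : FractionForm P q k₁ k₂) (l : FIRIndex k₁ k₂ → ℝ) :
    IsGLB {h : ℝ | ∃ (ε : ℝ) (k : ℕ), 0 < ε ∧ R.SOSConstraint l h ε k} (rate P q l ^ 2) := by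
  refine isGLB_of_forall_lt ?_ fun h hh => ?_
  · rintro h ⟨ε, k, hε, hs⟩
    exact sq_rate_le_of_normSq_lt hn (R.lt_of_SOSConstraint l hε hs)
  · exact R.exists_SOSConstraint l h fun z hz lam hlam => normSq_lt_of_sq_rate_lt hh hz hlam

lemma isGLB_RateConstraint (hn : 0 < n) (l : FIRIndex k₁ k₂ → ℝ) :
    IsGLB {g : ℝ | 0 ≤ g ∧ RateConstraint P q l g} (rate P q l) := by
  refine isGLB_of_forall_lt ?_ fun g hg => ?_
  · rintro g ⟨hg, h⟩
    exact (pow_le_pow_iff_left₀ (rate_nonneg P q l) hg two_ne_zero).mp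
      (sq_rate_le_of_normSq_lt hn fun z hz lam hlam => sub_pos.mp (h z hz lam hlam))
  · have hg0 := (rate_nonneg P q l).trans hg.le
    exact ⟨hg0, fun z hz lam hlam => sub_pos.mpr (normSq_lt_of_sq_rate_lt
      (pow_lt_pow_left₀ hg (rate_nonneg P q l) two_ne_zero) hz hlam)⟩

lemma isGLB_exists {ι : Type*} {s : ι → Set ℝ} {a : ι → ℝ} (h : ∀ i, IsGLB (s i) (a i)) {i₀ : ι}
    (hi₀ : ∀ i, a i₀ ≤ a i) : IsGLB {x | ∃ i, x ∈ s i} (a i₀) := by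
  refine ⟨?_, fun b hb => (h i₀).2 fun x hx => hb ⟨i₀, hx⟩⟩
  rintro x ⟨i, hx⟩
  exact (hi₀ i).trans ((h i).1 hx)

end

end ILC

end

theorem theorem2 {n : ℕ} (hn : 0 < n) (P : ILC.UncertainPlant n) (k₁ k₂ k₃ k₄ : ℕ)
    (q : ILC.FIRIndex k₃ k₄ → ℝ) :
    Nonempty (ILC.FractionForm P q k₁ k₂) ∧
    ∀ R : ILC.FractionForm P q k₁ k₂, ∃ γ η : ℝ,
      -- `γ` is the optimal value of the min–max `H∞` problem, and it is attained
      IsLeast (Set.range fun l : ILC.FIRIndex k₁ k₂ → ℝ => ILC.robustRate P q l)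
        (ENNReal.ofReal γ) ∧
      -- `γ` is the optimal value of the constrained form of that problem
      IsGLB {g : ℝ | 0 ≤ g ∧ ∃ l : ILC.FIRIndex k₁ k₂ → ℝ, ILC.RateConstraint P q l g} γ ∧
      -- `η` is the optimal value of the SOS program
      IsGLB {h : ℝ | ∃ (ε : ℝ) (k : ℕ) (l : ILC.FIRIndex k₁ k₂ → ℝ),
        0 < ε ∧ R.SOSConstraint l h ε k} η ∧
      γ = √η ∧
      -- the three problems have the same optimal `l`
      ∀ l : ILC.FIRIndex k₁ k₂ → ℝ,
        (ILC.robustRate P q l = ENNReal.ofReal γ ↔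
          IsGLB {h : ℝ | ∃ (ε : ℝ) (k : ℕ), 0 < ε ∧ R.SOSConstraint l h ε k} η) ∧
        (IsGLB {g : ℝ | 0 ≤ g ∧ ILC.RateConstraint P q l g} γ ↔
          IsGLB {h : ℝ | ∃ (ε : ℝ) (k : ℕ), 0 < ε ∧ R.SOSConstraint l h ε k} η) := by
  refine ⟨ILC.nonempty_fractionForm P k₁ k₂ q, fun R => ?_⟩
  obtain ⟨l₀, hl₀⟩ := ILC.exists_rate_le P q k₁ k₂
  have h0 := ILC.rate_nonneg P q l₀
  have hsos := ILC.isGLB_SOSConstraint hn R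
  have hrate := ILC.isGLB_RateConstraint (P := P) (q := q) (k₁ := k₁) (k₂ := k₂) hn
  refine ⟨ILC.rate P q l₀, ILC.rate P q l₀ ^ 2, ?_, ?_, ?_, (Real.sqrt_sq h0).symm, fun l => ?_⟩
  · refine ⟨⟨l₀, ILC.robustRate_eq P q l₀⟩, ?_⟩
    rintro _ ⟨l, rfl⟩
    simp only [ILC.robustRate_eq P q l]
    exact ENNReal.ofReal_le_ofReal (hl₀ l)
  · convert ILC.isGLB_exists hrate hl₀ using 2
    ext g
    simp
  · convert ILC.isGLB_exists hsos fun l => pow_le_pow_left₀ h0 (hl₀ l) 2 using 2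
    ext h
    exact ⟨fun ⟨ε, k, l, hl⟩ => ⟨l, ε, k, hl⟩, fun ⟨l, ε, k, hl⟩ => ⟨ε, k, l, hl⟩⟩
  · have hl := ILC.rate_nonneg P q l
    have key : IsGLB {h : ℝ | ∃ (ε : ℝ) (k : ℕ), 0 < ε ∧ R.SOSConstraint l h ε k}
        (ILC.rate P q l₀ ^ 2) ↔ ILC.rate P q l = ILC.rate P q l₀ :=
      ⟨fun h => (pow_left_inj₀ hl h0 two_ne_zero).mp ((hsos l).unique h), fun h => h ▸ hsos l⟩
    refine ⟨?_, ?_⟩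
    · rw [key, ILC.robustRate_eq, ENNReal.ofReal_eq_ofReal_iff hl h0]
    · rw [key]
      exact ⟨fun h => (hrate l).unique h, fun h => h ▸ hrate l⟩
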